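/- **Setting.** Let $n,m\ge 1$ and consider $\dot x=Ax+Bu+d$ with $x\in\mathbb R^n$, $u\in\mathbb R^m$, $A,B$ unknown real matrices, and $d:\mathbb R_{\ge0}\to\mathbb R^n$ Lebesgue measurable and bounded; $\|d\|_{[0,t]}=\sup_{s\in[0,t]}|d(s)|$, $\|d\|_\infty=\sup_{s\ge0}|d(s)|$. Off-line data matrices $U_0\in\mathbb R^{m\times T}$, $X_0,X_1\in\mathbb R^{n\times T}$ are known and satisfy $X_1=AX_0+BU_0+D_0$ with $D_0$ unknown. For matrices $\|\cdot\|$ is the induced 2-norm. **Hypotheses.** (i) $\begin{bmatrix}U_0\\X_0\end{bmatrix}$ has full row rank, and $D_0D_0^\top\preceq\Delta\Delta^\top$ with $\Delta\in\mathbb R^{n\times s}$ known. (ii) $\Omega\succ0$, and $\epsilon_0>0$, $Y\in\mathbb R^{T\times n}$ satisfy $$\begin{bmatrix}X_1Y+(X_1Y)^\top+\Omega+\epsilon_0\Delta\Delta^\top & Y^\top\\ Y&-\epsilon_0I\end{bmatrix}\prec0,\qquad X_0Y\succ0 ;$$ put $S=(X_0Y)^{-1}$, $K=U_0YS$. Let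 $G,L,J_0,V_0$ be any matrices with $\begin{bmatrix}U_0\\X_0\end{bmatrix}G=\begin{bmatrix}K\\I\end{bmatrix}$, $\begin{bmatrix}U_0\\X_0\end{bmatrix}L=\begin{bmatrix}K\\0\end{bmatrix}$, $\begin{bmatrix}U_0\\X_0\end{bmatrix}\begin{bmatrix}J_0&V_0\end{bmatrix}=I$. (iii) $\mu,\epsilon,\sigma_2>0$ and a symmetric $\widetilde\Psi\in\mathbb R^{2n\times2n}$ satisfy $$\begin{bmatrix}-\frac{\mu S\Omega S}{2}&\mu SX_1L&\mu S\Delta\\ \star&\epsilon L^\top L&0\\ \star&\star&-\epsilon I\end{bmatrix}\preceq\begin{bmatrix}\widetilde\Psi&0\\0&0\end{bmatrix},\qquad \widetilde\Psi\preceq\begin{bmatrix}-2\sigma_2^2I&0\\0&I\end{bmatrix}.$$ **Constants.** $c_A=\|X_1V_0\|+\|\Delta\|\|V_0\|$, $c_\Phi=\|X_1G\|+\|\Delta\|\|G\|$, $c_L=\|X_1L\|+\|\Delta\|\|L\|$. Let $\omega_1$ be the smallest eigenvalue of $S\Omega S$, $\omega_2=2\|SX_1L\|+2\|S\|\|\Delta\|\|L\|$,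 and let $\sigma_1>0$ with $\sigma_1\omega_2<\omega_1$. Let $$\tau_d(\sigma_1)=\frac1{c_A}\log\Big(\frac{\sigma_1}{1+\sigma_1}\frac{c_A}{\max\{c_\Phi,1\}}+1\Big)\ \text{ if } c_A\neq0,\qquad \tau_d(\sigma_1)=\frac{\sigma_1}{1+\sigma_1}\frac1{\max\{c_\Phi,1\}}\ \text{ if } c_A=0.$$ Let $\overline\tau_d\in\{0,\tau_d(\sigma_1)\}$, $\lambda>0$, $\theta\ge0$, $\nu\ge0$. For $\nu>0$ let $$\widetilde\tau(\sigma_2)=\frac1{\overline\alpha}\,\frac{\sigma_2}{1+\sigma_2},\qquad \overline\alpha=\max\Big\{c_\Phi,\,c_L,\,\frac{\sigma_2\|d\|_\infty}{\sqrt{\nu/2}}\Big\},$$ and let $\widetilde\tau(\sigma_2)=0$ for $\nu=0$. **Closed loop.** With transmission times $t_0=0,t_1,\dots$, $e(t)=x(t_k)-x(t)$ and $z=(x,e)$, on every $[t_k,t_{k+1}]$ the functions $x,\eta$ are (locally) absolutely continuous and satisfy, for almost every $t$, $$\dot x=(A+BK)x+BKe+d,\qquad \dot\eta\in-\lambda\eta-\psi(t-t_k)\big(z^\top\widetilde\Psi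 z-\nu\big),\qquad \eta(0)\ge0 .$$ If $\overline\tau_d=0$, then $\psi(s)=1$ for all $s\ge0$; if $\overline\tau_d=\tau_d(\sigma_1)$, then $\psi(s)=0$ for $s<\overline\tau_d$, $\psi(s)=[0,1]$ for $s=\overline\tau_d$, $\psi(s)=1$ for $s>\overline\tau_d$. Neither $x$ nor $\eta$ jumps. The transmission times are $$t_{k+1}=\inf\{t\ge t_k+\overline\tau_d:\ \eta(t)-\theta(z(t)^\top\widetilde\Psi z(t)-\nu)\le0\},$$ where, when $\theta=0$ and $\overline\tau_d=0$, it is also required that $-\lambda\eta(t)-(z(t)^\top\widetilde\Psi z(t)-\nu)\le0$ (that is, $\dot\eta(t)\le 0$); $\inf\emptyset=+\infty$. Solutions are maximal (they cannot be extended). **Proposition.** If $\overline\tau_d=\tau_d(\sigma_1)$ or $\nu>0$, then: (a) for every disturbance $d$, every solution and every $k$ such that $t_{k+1}$ is finite, $t_{k+1}-t_k\ge\overline\tau_d$; and if $\theta>0$ or $\overline\tau_d=0$, then $t_{k+1}-t_k\ge\max\{\overline\tau_d,\widetilde\tau(\sigma_2)\}$; (b) there exist $c_1\ge1$ and $c_2,c_3,c_4>0$,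 independent of the solution and of $d$, such that every solution $(x,\eta)$ with disturbance $d$ is defined on $[0,\infty)$ and satisfies, for every $t\ge0$, $\eta(t)\ge0$ and $$|(x(t),\sqrt{\eta(t)})|\le c_1e^{-c_2t}|(x(0),\sqrt{\eta(0)})|+c_3\|d\|_{[0,t]}+c_4\nu .$$ -/

import Mathlib

open Matrix MeasureTheory

namespace EventTriggered

noncomputable section

/-- The state space: real vectors of length `n` with the Euclidean norm. -/
abbrev Vec (n : ℕ) : Type := EuclideanSpace ℝ (Fin n)

section MatrixNorms

open scoped Matrix.Norms.L2Operator

/-- The induced 2-norm of a real (rectangular) matrix. -/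
def norm2 {p q : ℕ} (M : Matrix (Fin p) (Fin q) ℝ) : ℝ := ‖M‖

end MatrixNorms

/-- The smallest (real) eigenvalue, used for symmetric matrices only. -/
def minEig {n : ℕ} (M : Matrix (Fin n) (Fin n) ℝ) : ℝ := sInf (spectrum ℝ M)

/-- `‖d‖_{[0,t]}`. -/
def supNormOn {n : ℕ} (d : ℝ → Vec n) (t : ℝ) : ℝ :=
  sSup ((fun s => ‖d s‖) '' Set.Icc 0 t)

/-- `‖d‖_∞`, the supremum over `[0,∞)`. -/
def supNorm {n : ℕ} (d : ℝ → Vec n) : ℝ :=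
  sSup ((fun s => ‖d s‖) '' Set.Ici 0)

/-- Input disturbances: Lebesgue measurable and bounded on `[0,∞)`. -/
def IsDisturbance {n : ℕ} (d : ℝ → Vec n) : Prop :=
  AEMeasurable d (volume.restrict (Set.Ici 0)) ∧
    BddAbove ((fun s => ‖d s‖) '' Set.Ici 0)

/-! ### The matrix inequalities -/

/-- The linear matrix inequalities that define the controller gain, with decision variables
`ε` and `Y`. -/
def ControllerLMI {n T s : ℕ} (X0 X1 : Matrix (Fin n) (Fin T) ℝ) (Δ : Matrix (Fin n) (Fin s) ℝ)
    (Ω : Matrix (Fin n) (Fin n) ℝ) (ε : ℝ) (Y : Matrix (Fin T) (Fin n) ℝ) : Prop :=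
  (-(fromBlocks (X1 * Y + (X1 * Y)ᵀ + Ω + ε • (Δ * Δᵀ)) Yᵀ
      Y (-(ε • (1 : Matrix (Fin T) (Fin T) ℝ))))).PosDef ∧
  (X0 * Y).PosDef

/-- `Ψ̄(σ) = diag(-2σ² I, I)`. -/
def PsiBar (n : ℕ) (σ : ℝ) : Matrix (Fin n ⊕ Fin n) (Fin n ⊕ Fin n) ℝ :=
  fromBlocks (-((2 * σ ^ 2) • (1 : Matrix (Fin n) (Fin n) ℝ))) 0
    0 (1 : Matrix (Fin n) (Fin n) ℝ)

/-- The left-hand side of the first triggering inequality. -/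
def trigLHS {n T s : ℕ} (X1 : Matrix (Fin n) (Fin T) ℝ) (Δ : Matrix (Fin n) (Fin s) ℝ)
    (Ω S : Matrix (Fin n) (Fin n) ℝ) (L : Matrix (Fin T) (Fin n) ℝ) (μ ε : ℝ) :
    Matrix ((Fin n ⊕ Fin n) ⊕ Fin s) ((Fin n ⊕ Fin n) ⊕ Fin s) ℝ :=
  fromBlocks
    (fromBlocks (-((μ / 2) • (S * Ω * S))) (μ • (S * X1 * L))
      (μ • (S * X1 * L))ᵀ (ε • (Lᵀ * L)))
    (fromRows (μ • (S * Δ)) (0 : Matrix (Fin n) (Fin s) ℝ))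
    (fromRows (μ • (S * Δ)) (0 : Matrix (Fin n) (Fin s) ℝ))ᵀ
    (-(ε • (1 : Matrix (Fin s) (Fin s) ℝ)))

/-- The linear matrix inequalities that define the matrix `Ψ` of the triggering rule, with
decision variables `μ`, `ε`, `σ₂` and `Ψ`. -/
def TriggerLMI {n T s : ℕ} (X1 : Matrix (Fin n) (Fin T) ℝ) (Δ : Matrix (Fin n) (Fin s) ℝ)
    (Ω S : Matrix (Fin n) (Fin n) ℝ) (L : Matrix (Fin T) (Fin n) ℝ) (μ ε σ₂ : ℝ)
    (Ψ : Matrix (Fin n ⊕ Fin n) (Fin n ⊕ Fin n) ℝ) : Prop :=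
  (fromBlocks Ψ 0 0 0 - trigLHS X1 Δ Ω S L μ ε).PosSemidef ∧
  (PsiBar n σ₂ - Ψ).PosSemidef

/-! ### The data-based constants -/

/-- `‖X₁ M‖ + ‖Δ‖ ‖M‖`. With `M = V₀`, `G`, `L` this is the data-based bound on the norm of
`A`, `A + BK`, `BK` respectively. -/
def dataBound {n T s : ℕ} (X1 : Matrix (Fin n) (Fin T) ℝ) (Δ : Matrix (Fin n) (Fin s) ℝ)
    (M : Matrix (Fin T) (Fin n) ℝ) : ℝ :=
  norm2 (X1 * M) + norm2 Δ * norm2 M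

/-- `ω₂ = 2 ‖S X₁ L‖ + 2 ‖S‖ ‖Δ‖ ‖L‖`. -/
def omega2 {n T s : ℕ} (X1 : Matrix (Fin n) (Fin T) ℝ) (Δ : Matrix (Fin n) (Fin s) ℝ)
    (S : Matrix (Fin n) (Fin n) ℝ) (L : Matrix (Fin T) (Fin n) ℝ) : ℝ :=
  2 * norm2 (S * X1 * L) + 2 * norm2 S * norm2 Δ * norm2 L

/-- The time `τ_d(σ)` as a function of `c_A`, `c_Φ` and `σ`; at `c_A = 0` it is given its
limit value. -/
def tauD (cA cΦ σ : ℝ) : ℝ :=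
  if cA = 0 then σ / (1 + σ) / max cΦ 1
  else 1 / cA * Real.log (σ / (1 + σ) * (cA / max cΦ 1) + 1)

/-- The time `τ̃(σ)` as a function of `c_Φ`, `c_L`, `σ`, `ν` and `δ = ‖d‖_∞`. The threshold `ν`
on the quadratic form `|e|² - 2σ²|x|²` corresponds to the threshold `√(ν/2)` on
`|e| - σ|x|`. -/
def tauTilde (cΦ cL σ ν δ : ℝ) : ℝ :=
  if 0 < ν then 1 / max (max cΦ cL) (σ * δ / Real.sqrt (ν / 2)) * (σ / (1 + σ)) else 0

/-! ### The closed-loop system -/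

/-- The quadratic form `zᵀ Ψ z` with `z = (x, e)`. -/
def quad {n : ℕ} (Ψ : Matrix (Fin n ⊕ Fin n) (Fin n ⊕ Fin n) ℝ) (x e : Vec n) : ℝ :=
  Sum.elim x.ofLp e.ofLp ⬝ᵥ (Ψ *ᵥ Sum.elim x.ofLp e.ofLp)

/-- The set-valued map `ψ` on `[0,∞)`. -/
def psi (τ s : ℝ) : Set ℝ :=
  if τ = 0 then {1}
  else if s < τ then {0}
  else if s = τ then Set.Icc 0 1
  else {1}

/-- The parameters of the closed loop with a dynamic triggering rule; `τ` is the dwell time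
imposed by the rule. -/
structure Loop (n m : ℕ) where
  A : Matrix (Fin n) (Fin n) ℝ
  B : Matrix (Fin n) (Fin m) ℝ
  K : Matrix (Fin m) (Fin n) ℝ
  Ψ : Matrix (Fin n ⊕ Fin n) (Fin n ⊕ Fin n) ℝ
  lam : ℝ
  θ : ℝ
  ν : ℝ
  τ : ℝ

/-- The right-hand side `(A + BK) x + BK e + d`. -/
def Loop.field {n m : ℕ} (P : Loop n m) (x e d : Vec n) : Vec n :=
  toEuclideanLin (P.A + P.B * P.K) x + toEuclideanLin (P.B * P.K) e + d

/-- The state-dependent part of the triggering rule. In the absence of both time-regularization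
(`τ = 0`) and of the term weighted by `θ`, a transmission also requires `η̇ ≤ 0`. -/
def Loop.Trig {n m : ℕ} (P : Loop n m) (x e : Vec n) (η : ℝ) : Prop :=
  η - P.θ * (quad P.Ψ x e - P.ν) ≤ 0 ∧
    (P.θ = 0 → P.τ = 0 → -P.lam * η - (quad P.Ψ x e - P.ν) ≤ 0)

/-- A candidate solution: its domain, the index set of its transmission times, the
transmission times, and the trajectories of the plant and of the auxiliary variable. -/
structure Arc (n : ℕ) where
  dom : Set ℝ
  idx : Set ℕ
  t : ℕ → ℝ
  x : ℝ → Vec n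
  η : ℝ → ℝ

/-- The sampling-induced error on the `k`-th inter-transmission interval. -/
def Arc.e {n : ℕ} (φ : Arc n) (k : ℕ) (s : ℝ) : Vec n := φ.x (φ.t k) - φ.x s

/-- The `k`-th interval of flow: `[t_k, t_{k+1}]`, or the part of the domain after `t_k` when
`t_k` is the last transmission time. -/
def Arc.flow {n : ℕ} (φ : Arc n) (k : ℕ) : Set ℝ :=
  {s | s ∈ φ.dom ∧ φ.t k ≤ s ∧ (k + 1 ∈ φ.idx → s ≤ φ.t (k + 1))}

/-- The times of the domain at which the rule allows the transmission that follows `t_k`. -/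
def Arc.trigSet {n m : ℕ} (φ : Arc n) (P : Loop n m) (k : ℕ) : Set ℝ :=
  {s | s ∈ φ.dom ∧ φ.t k + P.τ ≤ s ∧ P.Trig (φ.x s) (φ.e k s) (φ.η s)}

/-- `φ` is a (not necessarily maximal) solution of the closed loop `P` with input disturbance
`d`: on every interval of flow, `x` and `η` are absolutely continuous and satisfy the
differential equation and the differential inclusion almost everywhere; neither jumps. -/
structure IsSolution {n m : ℕ} (P : Loop n m) (d : ℝ → Vec n) (φ : Arc n) : Prop where
  zero_mem : (0 : ℝ) ∈ φ.dom
  dom_nonneg : φ.dom ⊆ Set.Ici 0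
  ordConnected : φ.dom.OrdConnected
  zero_idx : 0 ∈ φ.idx
  idx_pred : ∀ k, k + 1 ∈ φ.idx → k ∈ φ.idx
  t_zero : φ.t 0 = 0
  t_mem : ∀ k ∈ φ.idx, φ.t k ∈ φ.dom
  cover : ∀ s ∈ φ.dom, ∃ k ∈ φ.idx, s ∈ φ.flow k
  η_init : 0 ≤ φ.η 0
  ac_x : ∀ k ∈ φ.idx, ∀ s ∈ φ.flow k, AbsolutelyContinuousOnInterval φ.x (φ.t k) s
  ac_η : ∀ k ∈ φ.idx, ∀ s ∈ φ.flow k, AbsolutelyContinuousOnInterval φ.η (φ.t k) s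
  deriv_x : ∀ k ∈ φ.idx, ∀ᵐ s, s ∈ φ.flow k →
    HasDerivAt φ.x (P.field (φ.x s) (φ.e k s) (d s)) s
  deriv_η : ∀ k ∈ φ.idx, ∀ᵐ s, s ∈ φ.flow k → ∃ c ∈ psi P.τ (s - φ.t k),
    HasDerivAt φ.η (-P.lam * φ.η s - c * (quad P.Ψ (φ.x s) (φ.e k s) - P.ν)) s
  /-- the next transmission time is the infimum of the trigger set ... -/
  next : ∀ k ∈ φ.idx, k + 1 ∈ φ.idx → IsLeast (φ.trigSet P k) (φ.t (k + 1))
  /-- ... which is `+∞` when the trigger set is empty. -/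
  last : ∀ k ∈ φ.idx, k + 1 ∉ φ.idx → φ.trigSet P k = ∅

/-- `φ'` extends `φ`. -/
def Arc.Extends {n : ℕ} (φ' φ : Arc n) : Prop :=
  φ.dom ⊆ φ'.dom ∧ φ.idx ⊆ φ'.idx ∧ (∀ k ∈ φ.idx, φ'.t k = φ.t k) ∧
    ∀ s ∈ φ.dom, φ'.x s = φ.x s ∧ φ'.η s = φ.η s

/-- Maximal solutions: those that cannot be extended. -/
def IsMaximalSolution {n m : ℕ} (P : Loop n m) (d : ℝ → Vec n) (φ : Arc n) : Prop :=
  IsSolution P d φ ∧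
    ∀ φ' : Arc n, IsSolution P d φ' → φ'.Extends φ → φ'.dom = φ.dom ∧ φ'.idx = φ.idx

/-- The Euclidean norm `|(x, √η)|`. -/
def augNorm {n : ℕ} (x : Vec n) (η : ℝ) : ℝ := Real.sqrt (‖x‖ ^ 2 + Real.sqrt η ^ 2)

end

end EventTriggered

/-!
The closed loop is dissipative with the storage function `W = μ xᵀ S x + η`, `S = (X₀ Y)⁻¹`, in two
different ways. The data equation gives `A + B K = (X₁ - D₀) Y S` and `B K = (X₁ - D₀) L`, so
that the controller inequality, with its noise term eliminated by completing squares, bounds the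
derivative of `xᵀ S x` without sampling error by `-xᵀ S Ω S x` (`closedLoop_form_le`). The effect of
the sampling error `e` is bounded either by the triggering form, `quad Ψ x e`, at the price of half
of that decrease (`sampled_form_le_quad`), or by `ω₂ |x| |e|` (`sampled_form_le_omega2`).

After the dwell time the triggering form cancels between the derivatives of `μ xᵀ S x` and of `η`.
During the dwell time `η` decays freely, and `|e| ≤ σ₁ (|x| + ‖d‖)`: the number `τ_d(σ₁)` is the
time at which the Grönwall bound for `ė = A e - (A + B K) x(t_k) - d` reaches `σ₁ / (1 + σ₁)` times
`|x(t_k)| + ‖d‖` (`IsSolution.error_le`). In both phases `W' ≤ -c W + C ‖d‖² + ν` almost everywhere,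
hence the exponential estimate for `W` and, after a square root, for `|(x, √η)|`; the offset is of
the order of `√ν`, which is a multiple of `ν` because the constants may depend on `ν`.

The variable `η` stays nonnegative because it cannot decrease where it is negative and no
transmission is triggered (`aux_nonneg`). Therefore `quad Ψ x e ≥ ν` at a transmission that is not
caused by the end of the dwell time alone, and then `|e| ≥ σ₂ (|x| + w)` with `w = √(ν/2) / σ₂`. The
relative error `|e| / (|e| + |x| + w)` starts from zero, grows at a rate of at most `ᾱ`
(`relative_error_le`), and equals at least `σ₂ / (1 + σ₂)` at the transmission, which is the lower
bound `τ̃(σ₂)` for the inter-event time.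

In either case the inter-event times of a solution are bounded away from zero, so that a maximal
solution with a bounded domain would have a last transmission. Its last interval of flow could be
continued by solving linear equations with a measurable input, up to the next transmission or
forever (`IsSolution.exists_extension`); hence maximal solutions are complete.

Since `x` and `η` are only absolutely continuous, differential inequalities hold almost everywhere.
They are integrated by the fundamental theorem of calculus for absolutely continuous functions, and
turned into bounds on right slopes at every point, by `eventually_norm_sub_le`, where Grönwall's
inequality from Mathlib is used.
-/

namespace EventTriggered

open Set Filter Topology

/-! ### Absolutely continuous functions and differential inequalities -/

/-- Absolute continuity passes to every function whose increments are dominated, up to a constant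
factor, by those of an absolutely continuous one. -/
lemma absolutelyContinuous_of_dist_le {X Y : Type*} [PseudoMetricSpace X] [PseudoMetricSpace Y]
    {f : ℝ → X} {g : ℝ → Y} {a b C : ℝ} (hf : AbsolutelyContinuousOnInterval f a b)
    (h : ∀ s ∈ uIcc a b, ∀ t ∈ uIcc a b, dist (g s) (g t) ≤ C * dist (f s) (f t)) :
    AbsolutelyContinuousOnInterval g a b := by
  have h0 : Tendsto (fun E : ℕ × (ℕ → ℝ × ℝ) ↦
      C * ∑ i ∈ Finset.range E.1, dist (f (E.2 i).1) (f (E.2 i).2))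
      (AbsolutelyContinuousOnInterval.totalLengthFilter ⊓
        𝓟 (AbsolutelyContinuousOnInterval.disjWithin a b)) (𝓝 0) := by
    simpa using Tendsto.const_mul C hf
  refine squeeze_zero' (Eventually.of_forall fun E ↦ Finset.sum_nonneg fun i _ ↦ dist_nonneg) ?_ h0
  filter_upwards [mem_inf_of_right (mem_principal_self _)] with E hE
  rw [Finset.mul_sum]
  exact Finset.sum_le_sum fun i hi ↦ h _ (hE.1 i hi).1 _ (hE.1 i hi).2

lemma ae_ne (a : ℝ) : ∀ᵐ s : ℝ, s ≠ a := by simp [ae_iff, measure_singleton]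

lemma absolutelyContinuous_congr {X : Type*} [PseudoMetricSpace X] {f g : ℝ → X} {a b : ℝ}
    (hf : AbsolutelyContinuousOnInterval f a b) (h : EqOn g f (uIcc a b)) :
    AbsolutelyContinuousOnInterval g a b :=
  absolutelyContinuous_of_dist_le (C := 1) hf fun s hs t ht ↦ by rw [h hs, h ht, one_mul]

lemma absolutelyContinuous_mono {X : Type*} [PseudoMetricSpace X] {f : ℝ → X} {a b c d : ℝ}
    (hf : AbsolutelyContinuousOnInterval f a b) (hac : a ≤ c) (hcd : c ≤ d) (hdb : d ≤ b) :
    AbsolutelyContinuousOnInterval f c d := by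
  refine hf.mono ?_
  rw [uIcc_of_le hcd, uIcc_of_le (hac.trans (hcd.trans hdb))]
  exact Icc_subset_Icc hac hdb

lemma absolutelyContinuous_add_const {E : Type*} [NormedAddCommGroup E] {f : ℝ → E} {a b : ℝ}
    (hf : AbsolutelyContinuousOnInterval f a b) (c : E) :
    AbsolutelyContinuousOnInterval (fun s ↦ f s + c) a b :=
  absolutelyContinuous_of_dist_le (C := 1) hf fun s _ t _ ↦ by simp

lemma absolutelyContinuous_const_sub {E : Type*} [NormedAddCommGroup E] {f : ℝ → E} {a b : ℝ}
    (hf : AbsolutelyContinuousOnInterval f a b) (c : E) :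
    AbsolutelyContinuousOnInterval (fun s ↦ c - f s) a b :=
  absolutelyContinuous_of_dist_le (C := 1) hf fun s _ t _ ↦ by rw [dist_sub_left, one_mul]

/-- The mean value inequality for absolutely continuous functions. -/
lemma sub_le_of_ae_deriv_le {f f' : ℝ → ℝ} {a b C : ℝ} (hab : a ≤ b)
    (hf : AbsolutelyContinuousOnInterval f a b)
    (hd : ∀ᵐ s, s ∈ Icc a b → HasDerivAt f (f' s) s) (hC : ∀ᵐ s, s ∈ Icc a b → f' s ≤ C) :
    f b - f a ≤ C * (b - a) := by
  rw [← hf.integral_deriv_eq_sub]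
  have h : ∫ s in a..b, deriv f s ≤ ∫ _ in a..b, C := by
    refine intervalIntegral.integral_mono_ae_restrict hab hf.intervalIntegrable_deriv
      intervalIntegrable_const ?_
    rw [EventuallyLE, ae_restrict_iff' measurableSet_Icc]
    filter_upwards [hd, hC] with s h1 h2 hs
    rw [(h1 hs).deriv]
    exact h2 hs
  refine h.trans (le_of_eq ?_)
  rw [intervalIntegral.integral_const, smul_eq_mul, mul_comm]

/-- The mean value inequality for absolutely continuous functions with values in an inner product
space, reduced to real functions by pairing with the increment. -/
lemma norm_sub_le_of_ae_norm_deriv_le {E : Type*} [NormedAddCommGroup E] [InnerProductSpace ℝ E]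
    {f f' : ℝ → E} {a b C : ℝ} (hab : a ≤ b) (hf : AbsolutelyContinuousOnInterval f a b)
    (hd : ∀ᵐ s, s ∈ Icc a b → HasDerivAt f (f' s) s) (hC : ∀ᵐ s, s ∈ Icc a b → ‖f' s‖ ≤ C) :
    ‖f b - f a‖ ≤ C * (b - a) := by
  rcases hab.eq_or_lt with rfl | hlt
  · simp
  set u := f b - f a with hu
  have h := sub_le_of_ae_deriv_le (f := fun s ↦ inner ℝ u (f s)) (f' := fun s ↦ inner ℝ u (f' s))
    (C := ‖u‖ * C) hab
    (absolutelyContinuous_of_dist_le (C := ‖u‖) hf fun s _ t _ ↦ by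
      rw [dist_eq_norm, dist_eq_norm, ← inner_sub_right]
      exact norm_inner_le_norm _ _)
    (by
      filter_upwards [hd] with s h1 hs
      simpa using (hasDerivAt_const s u).inner ℝ (h1 hs))
    (by
      filter_upwards [hC] with s h1 hs
      exact (real_inner_le_norm _ _).trans (mul_le_mul_of_nonneg_left (h1 hs) (norm_nonneg _)))
  have h2 : inner ℝ u (f b) - inner ℝ u (f a) = ‖u‖ * ‖u‖ := by
    rw [← inner_sub_right, ← hu, real_inner_self_eq_norm_mul_norm]
  simp only [h2] at h
  rcases (norm_nonneg u).eq_or_lt with h0 | h0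
  · rw [← h0]
    have hne : ∃ s, ‖f' s‖ ≤ C := by
      by_contra! hcon
      have : volume (Icc a b) = 0 := by
        refine measure_mono_null (fun s hs ↦ ?_) hC
        exact fun h ↦ (hcon s).not_ge (h hs)
      rw [Real.volume_Icc, ENNReal.ofReal_eq_zero] at this
      linarith
    obtain ⟨s, hs⟩ := hne
    exact mul_nonneg ((norm_nonneg _).trans hs) (by linarith)
  · rw [mul_assoc] at h
    exact le_of_mul_le_mul_left h h0

/-- If the speed of `f` is at most `g` almost everywhere, with `g` continuous, then the increments
of `f` to the right of *every* point `s` are bounded by any slope larger than `g s`. -/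
lemma eventually_norm_sub_le {E : Type*} [NormedAddCommGroup E] [InnerProductSpace ℝ E]
    {f f' : ℝ → E} {g : ℝ → ℝ} {a b : ℝ} (hf : AbsolutelyContinuousOnInterval f a b)
    (hd : ∀ᵐ s, s ∈ Icc a b → HasDerivAt f (f' s) s) (hg : ContinuousOn g (Icc a b))
    (hC : ∀ᵐ s, s ∈ Icc a b → ‖f' s‖ ≤ g s) {s r : ℝ} (hs : s ∈ Ico a b) (hr : g s < r) :
    ∀ᶠ z in 𝓝[>] s, ‖f z - f s‖ ≤ r * (z - s) := by
  have h1 : ∀ᶠ u in 𝓝[Icc a b] s, g u < r :=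
    (hg s ⟨hs.1, hs.2.le⟩).eventually (gt_mem_nhds hr)
  rw [eventually_nhdsWithin_iff, Metric.eventually_nhds_iff] at h1
  obtain ⟨δ, hδ, h1⟩ := h1
  filter_upwards [Ioo_mem_nhdsGT (show s < min b (s + δ) from lt_min hs.2 (by linarith))] with z hz
  have hz1 : z < b := hz.2.trans_le (min_le_left _ _)
  have hz2 : z < s + δ := hz.2.trans_le (min_le_right _ _)
  have hsub : ∀ u ∈ Icc s z, u ∈ Icc a b := fun u hu ↦
    ⟨hs.1.trans hu.1, hu.2.trans hz1.le⟩
  refine norm_sub_le_of_ae_norm_deriv_le hz.1.le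
    (absolutelyContinuous_mono hf hs.1 hz.1.le hz1.le) (f' := f') ?_ ?_
  · filter_upwards [hd] with u hu hu' using hu (hsub u hu')
  · filter_upwards [hC] with u hu hu'
    refine (hu (hsub u hu')).trans (h1 ?_ (hsub u hu')).le
    rw [Real.dist_eq, abs_of_nonneg (by linarith [hu'.1])]
    linarith [hu'.2]

/-- Grönwall's inequality for absolutely continuous functions. -/
lemma norm_le_gronwallBound_of_ae {E : Type*} [NormedAddCommGroup E] [InnerProductSpace ℝ E]
    {f f' : ℝ → E} {a b δ K ε : ℝ} (hab : a ≤ b) (hf : AbsolutelyContinuousOnInterval f a b)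
    (hd : ∀ᵐ s, s ∈ Icc a b → HasDerivAt f (f' s) s)
    (hC : ∀ᵐ s, s ∈ Icc a b → ‖f' s‖ ≤ K * ‖f s‖ + ε) (ha : ‖f a‖ ≤ δ) :
    ‖f b‖ ≤ gronwallBound δ K ε (b - a) := by
  have hcf : ContinuousOn f (Icc a b) := by simpa [uIcc_of_le hab] using hf.continuousOn
  refine le_gronwallBound_of_liminf_deriv_right_le (f := fun s ↦ ‖f s‖)
    (f' := fun s ↦ K * ‖f s‖ + ε) hcf.norm ?_ ha (fun _ _ ↦ le_rfl) b ⟨hab, le_rfl⟩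
  intro s hs r hr
  obtain ⟨r', hr1, hr2⟩ := exists_between hr
  have h := eventually_norm_sub_le hf hd (g := fun s ↦ K * ‖f s‖ + ε)
    ((continuousOn_const.mul hcf.norm).add continuousOn_const) hC hs hr1
  refine Eventually.frequently ?_
  filter_upwards [h, self_mem_nhdsWithin] with z hz hzs
  have hpos : 0 < z - s := sub_pos.mpr hzs
  rw [inv_mul_lt_iff₀ hpos]
  have := norm_sub_norm_le (f z) (f s)
  nlinarith

/-- The scalar linear comparison principle `f' ≤ -c f + κ`, for absolutely continuous `f`. -/
lemma le_exp_of_ae_deriv_le {f f' : ℝ → ℝ} {a b c κ : ℝ} (hc : 0 < c) (hab : a ≤ b)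
    (hf : AbsolutelyContinuousOnInterval f a b)
    (hd : ∀ᵐ s, s ∈ Icc a b → HasDerivAt f (f' s) s)
    (hC : ∀ᵐ s, s ∈ Icc a b → f' s ≤ -c * f s + κ) :
    f b - κ / c ≤ Real.exp (-c * (b - a)) * (f a - κ / c) := by
  have hac : AbsolutelyContinuousOnInterval
      (fun s ↦ Real.exp (c * s) * (f s + (-(κ / c)))) a b := by
    refine AbsolutelyContinuousOnInterval.fun_mul ?_ (absolutelyContinuous_add_const hf _)
    refine ContDiffOn.absolutelyContinuousOnInterval (ContDiff.contDiffOn ?_)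
    fun_prop
  have h := sub_le_of_ae_deriv_le (C := 0) hab hac
    (f' := fun s ↦ (Real.exp (c * s) * c) * (f s + (-(κ / c))) + Real.exp (c * s) * f' s) (by
      filter_upwards [hd] with s hs hs'
      have h1 : HasDerivAt (fun s ↦ Real.exp (c * s)) (Real.exp (c * s) * c) s := by
        simpa using ((hasDerivAt_id s).const_mul c).exp
      exact h1.mul ((hs hs').add_const _)) (by
      filter_upwards [hC] with s hs hs'
      have h1 := hs hs'
      have h2 := Real.exp_pos (c * s)
      have h3 : c * (κ / c) = κ := by field_simp
      have h4 : Real.exp (c * s) * c * (f s + -(κ / c)) + Real.exp (c * s) * f' s =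
        Real.exp (c * s) * (f' s - (-c * f s + c * (κ / c))) := by ring
      rw [h4, h3]
      exact mul_nonpos_of_nonneg_of_nonpos h2.le (by linarith))
  have h5 : Real.exp (-c * (b - a)) = Real.exp (c * a) / Real.exp (c * b) := by
    rw [← Real.exp_sub]; congr 1; ring
  rw [h5, div_mul_eq_mul_div, le_div_iff₀ (Real.exp_pos _)]
  linarith

/-- How fast the relative error `‖e‖ / (‖e‖ + ‖x‖ + w)`, with `e = x(a) - x`, can grow when the
speed of `x` is at most `α (‖x‖ + ‖e‖ + w)`: at most at the rate `α`. In an increment `δ` of `x`,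
the norm of `e` grows by at most `δ` and that of `x` decreases by at most `δ`, so that the relative
error is increased the most when the denominator stays constant. -/
lemma relative_error_le {E : Type*} [NormedAddCommGroup E] [InnerProductSpace ℝ E]
    {x x' : ℝ → E} {a b α w : ℝ} (hab : a ≤ b) (hw : 0 < w)
    (hx : AbsolutelyContinuousOnInterval x a b)
    (hd : ∀ᵐ s, s ∈ Icc a b → HasDerivAt x (x' s) s)
    (hC : ∀ᵐ s, s ∈ Icc a b → ‖x' s‖ ≤ α * (‖x s‖ + ‖x a - x s‖ + w)) :
    ‖x a - x b‖ / (‖x a - x b‖ + (‖x b‖ + w)) ≤ α * (b - a) := by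
  have hcx : ContinuousOn x (Icc a b) := by simpa [uIcc_of_le hab] using hx.continuousOn
  have hce : ContinuousOn (fun s ↦ ‖x a - x s‖) (Icc a b) := (continuousOn_const.sub hcx).norm
  have hden : ∀ s, 0 < ‖x a - x s‖ + (‖x s‖ + w) := fun s ↦ by positivity
  have key := le_gronwallBound_of_liminf_deriv_right_le
    (f := fun s ↦ ‖x a - x s‖ / (‖x a - x s‖ + (‖x s‖ + w))) (f' := fun _ ↦ α) (δ := 0) (K := 0)
    (ε := α) (hce.div (hce.add (hcx.norm.add continuousOn_const)) fun s _ ↦ (hden s).ne') ?_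
    (by simp) (by simp) b ⟨hab, le_rfl⟩
  · simpa [gronwallBound_K0] using key
  intro s hs r hr
  set N := ‖x s‖ + w with hN
  set e := ‖x a - x s‖ with he
  have hNpos : 0 < N := by positivity
  have hD : 0 < e + N := hden s
  obtain ⟨r', hr1, hr2⟩ := exists_between hr
  have h1 := eventually_norm_sub_le hx hd (g := fun s ↦ α * (‖x s‖ + ‖x a - x s‖ + w))
    (continuousOn_const.mul ((hcx.norm.add hce).add continuousOn_const)) hC hs
    (r := r' * (e + N)) (by
      have : ‖x s‖ + ‖x a - x s‖ + w = e + N := by rw [he, hN]; ring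
      simp only [this]
      exact mul_lt_mul_of_pos_right hr1 hD)
  -- close to `s` the increment is smaller than `N`, which keeps the denominators positive
  have h2 : ∀ᶠ z in 𝓝[>] s, r' * (e + N) * (z - s) < N := by
    have : Tendsto (fun z ↦ r' * (e + N) * (z - s)) (𝓝[>] s) (𝓝 (r' * (e + N) * (s - s))) :=
      (Continuous.tendsto (by fun_prop) s).mono_left nhdsWithin_le_nhds
    exact this.eventually (gt_mem_nhds (by simpa using hNpos))
  refine Eventually.frequently ?_
  filter_upwards [h1, h2, self_mem_nhdsWithin] with z hz1 hz2 hzs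
  have hpos : 0 < z - s := sub_pos.mpr hzs
  set δ := r' * (e + N) * (z - s) with hδ
  have hδ0 : 0 ≤ δ := (norm_nonneg _).trans hz1
  have hb1 : ‖x a - x z‖ ≤ e + δ := by
    have : x a - x z = (x a - x s) - (x z - x s) := by abel
    rw [this]; exact (norm_sub_le _ _).trans (by linarith)
  have hb2 : N - δ ≤ ‖x z‖ + w := by
    have := norm_sub_norm_le (x s) (x z)
    rw [norm_sub_rev] at this
    rw [hN]; linarith
  have hb3 : ‖x a - x z‖ / (‖x a - x z‖ + (‖x z‖ + w)) ≤ (e + δ) / (e + N) := by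
    rw [div_le_div_iff₀ (hden z) hD]
    have h5 : ‖x a - x z‖ * (N - δ) ≤ (e + δ) * (‖x z‖ + w) :=
      mul_le_mul hb1 hb2 (by linarith) (by positivity)
    nlinarith
  rw [inv_mul_lt_iff₀ hpos]
  have hb4 : (e + δ) / (e + N) = e / (e + N) + r' * (z - s) := by
    rw [hδ]; field_simp
  nlinarith

/-! ### Linear differential equations with a measurable input -/

/-- The equation `x' = A x + w`, with `w` measurable and bounded on compact intervals, has a global
solution in the sense of Carathéodory, given by the variation of constants formula. -/
lemma exists_linear_ode_solution {E : Type*} [NormedAddCommGroup E] [NormedSpace ℝ E]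
    [CompleteSpace E] (A : E →L[ℝ] E) (w : ℝ → E) (a : ℝ) (x₀ : E)
    (hw : AEStronglyMeasurable w (volume.restrict (Ici a)))
    (hb : ∀ b, ∃ C, ∀ s ∈ Icc a b, ‖w s‖ ≤ C) :
    ∃ x : ℝ → E, x a = x₀ ∧ (∀ b, a ≤ b → AbsolutelyContinuousOnInterval x a b) ∧
      ∀ᵐ s, a < s → HasDerivAt x (A (x s) + w s) s := by
  set F : ℝ → E →L[ℝ] E := fun s ↦ NormedSpace.exp (s • A) with hF
  have hFd : ∀ s, HasDerivAt F (A * F s) s := fun s ↦ hasDerivAt_exp_smul_const' A s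
  have hFc : Continuous F := continuous_iff_continuousAt.mpr fun s ↦ (hFd s).continuousAt
  have hFinv : ∀ s, F s * F (-s) = 1 := by
    intro s
    have hcomm : Commute (s • A) (-s • A) :=
      ((Commute.refl A).smul_left s).smul_right (-s)
    have := NormedSpace.exp_add_of_commute_of_mem_ball (𝕂 := ℝ) hcomm
      (by simp [NormedSpace.expSeries_radius_eq_top])
      (by simp [NormedSpace.expSeries_radius_eq_top])
    rw [hF]
    simp only
    rw [← this]
    simp
  set v : ℝ → E := (Ici a).indicator w with hv
  have hvm : AEStronglyMeasurable v volume :=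
    (aestronglyMeasurable_indicator_iff measurableSet_Ici).mpr hw
  have hvb : ∀ b, ∃ C, 0 ≤ C ∧ ∀ s ≤ b, ‖v s‖ ≤ C := by
    intro b
    obtain ⟨C, hC⟩ := hb b
    refine ⟨max C 0, le_max_right _ _, fun s hs ↦ ?_⟩
    by_cases hsa : a ≤ s
    · rw [hv, indicator_of_mem (by exact hsa)]
      exact (hC s ⟨hsa, hs⟩).trans (le_max_left _ _)
    · rw [hv, indicator_of_notMem (by exact hsa), norm_zero]
      exact le_max_right _ _
  set g : ℝ → E := fun u ↦ F (-u) (v u) with hg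
  have hgm : AEStronglyMeasurable g volume := by
    have h1 : AEStronglyMeasurable (fun u ↦ F (-u)) volume :=
      (hFc.comp continuous_neg).aestronglyMeasurable
    exact (ContinuousLinearMap.apply ℝ E).flip.aestronglyMeasurable_comp₂ h1 hvm
  have hgb : ∀ c b, ∃ C, 0 ≤ C ∧ ∀ s ∈ Icc c b, ‖g s‖ ≤ C := by
    intro c b
    obtain ⟨C, hC0, hC⟩ := hvb b
    obtain ⟨C', hC'⟩ := (isCompact_Icc (a := c) (b := b)).exists_bound_of_continuousOn
      (hFc.comp continuous_neg).continuousOn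
    refine ⟨max C' 0 * C, by positivity, fun s hs ↦ ?_⟩
    exact (ContinuousLinearMap.le_opNorm _ _).trans
      (mul_le_mul ((hC' s hs).trans (le_max_left _ _)) (hC s hs.2) (norm_nonneg _)
        (le_max_right _ _))
  have hgi : LocallyIntegrable g volume := by
    rw [locallyIntegrable_iff]
    intro k hk
    obtain ⟨R, hR⟩ := hk.isBounded.subset_closedBall 0
    rw [Real.closedBall_eq_Icc] at hR
    obtain ⟨C, -, hC⟩ := hgb (0 - R) (0 + R)
    refine IntegrableOn.of_bound (hk.measure_lt_top) hgm.restrict C ?_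
    filter_upwards [ae_restrict_mem hk.measurableSet] with s hs using hC s (hR hs)
  set y : ℝ → E := fun s ↦ F (-a) x₀ + ∫ u in a..s, g u with hy
  have hyd : ∀ᵐ s, HasDerivAt y (g s) s := by
    filter_upwards [_root_.LocallyIntegrable.ae_hasDerivAt_integral hgi] with s hs
    exact (hs a).const_add _
  refine ⟨fun s ↦ F s (y s), ?_, ?_, ?_⟩
  · simp only [hy, intervalIntegral.integral_same, add_zero]
    rw [← mul_apply_eq_comp, hFinv, one_apply_eq_self]
  · intro b hab
    obtain ⟨C, hC0, hC⟩ := hgb a b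
    have hgii : ∀ s t, IntervalIntegrable g volume s t := fun s t ↦
      (hgi.integrableOn_isCompact isCompact_uIcc).intervalIntegrable
    have hylip : ∀ s ∈ Icc a b, ∀ t ∈ Icc a b, ‖y s - y t‖ ≤ C * |s - t| := by
      intro s hs t ht
      have h1 : y s - y t = ∫ u in t..s, g u := by
        rw [hy]
        simp only [add_sub_add_left_eq_sub]
        rw [intervalIntegral.integral_interval_sub_left (hgii _ _) (hgii _ _)]
      rw [h1]
      refine intervalIntegral.norm_integral_le_of_norm_le_const fun u hu ↦ hC u ?_
      rw [uIoc, mem_Ioc] at hu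
      exact ⟨(le_min ht.1 hs.1).trans hu.1.le, hu.2.trans (max_le ht.2 hs.2)⟩
    have hyb : ∀ s ∈ Icc a b, ‖y s‖ ≤ ‖y a‖ + C * (b - a) := by
      intro s hs
      have h1 := hylip s hs a ⟨le_rfl, hab⟩
      have h2 : |s - a| ≤ b - a := by
        rw [abs_of_nonneg (by linarith [hs.1])]; linarith [hs.2]
      have h3 := norm_sub_norm_le (y s) (y a)
      nlinarith
    have hFC : ContDiff ℝ 1 F := by
      rw [contDiff_one_iff_deriv]
      refine ⟨fun s ↦ (hFd s).differentiableAt, ?_⟩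
      have : deriv F = fun s ↦ A * F s := funext fun s ↦ (hFd s).deriv
      rw [this]
      exact continuous_const.mul hFc
    obtain ⟨K, hK⟩ := hFC.contDiffOn.exists_lipschitzOnWith (n := 1) (by decide)
      (convex_Icc a b) isCompact_Icc
    obtain ⟨C', hC'⟩ := (isCompact_Icc (a := a) (b := b)).exists_bound_of_continuousOn
      hFc.continuousOn
    have hid : AbsolutelyContinuousOnInterval (fun s : ℝ ↦ s) a b :=
      contDiff_id.contDiffOn.absolutelyContinuousOnInterval
    refine absolutelyContinuous_of_dist_le (C := K * (‖y a‖ + C * (b - a)) + C' * C) hid ?_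
    rw [uIcc_of_le hab]
    intro s hs t ht
    have h1 : F s (y s) - F t (y t) = (F s - F t) (y s) + F t (y s - y t) := by
      rw [_root_.sub_apply, map_sub]; abel
    have h2 := hK.dist_le_mul s hs t ht
    rw [dist_eq_norm] at h2 ⊢
    rw [h1, Real.dist_eq] at *
    refine (norm_add_le _ _).trans ?_
    rw [add_mul]
    refine add_le_add ?_ ?_
    · refine (ContinuousLinearMap.le_opNorm _ _).trans ?_
      calc _ ≤ (K * |s - t|) * (‖y a‖ + C * (b - a)) :=
            mul_le_mul h2 (hyb s hs) (norm_nonneg _) (by positivity)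
        _ = _ := by ring
    · refine (ContinuousLinearMap.le_opNorm _ _).trans ?_
      rw [mul_assoc]
      exact mul_le_mul (hC' t ht) (hylip s hs t ht) (norm_nonneg _)
        ((norm_nonneg _).trans (hC' t ht))
  · filter_upwards [hyd] with s hs hsa
    have h1 := (hFd s).clm_apply hs
    have h2 : F s (g s) = w s := by
      rw [hg]
      simp only
      rw [← mul_apply_eq_comp, hFinv, one_apply_eq_self, hv,
        indicator_of_mem (by exact hsa.le)]
    rwa [h2, mul_apply_eq_comp] at h1

/-- Carathéodory solutions of `x' = A x + w` are unique. -/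
lemma linear_ode_unique {E : Type*} [NormedAddCommGroup E] [InnerProductSpace ℝ E]
    (A : E →L[ℝ] E) (w : ℝ → E) {x y : ℝ → E} {a b : ℝ} (hab : a ≤ b)
    (hx : AbsolutelyContinuousOnInterval x a b) (hy : AbsolutelyContinuousOnInterval y a b)
    (hdx : ∀ᵐ s, s ∈ Icc a b → HasDerivAt x (A (x s) + w s) s)
    (hdy : ∀ᵐ s, s ∈ Icc a b → HasDerivAt y (A (y s) + w s) s) (h : x a = y a) :
    x b = y b := by
  have key := norm_le_gronwallBound_of_ae (f := fun s ↦ x s - y s)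
    (f' := fun s ↦ A (x s - y s)) (δ := 0) (K := ‖A‖) (ε := 0) hab (hx.fun_sub hy) (by
      filter_upwards [hdx, hdy] with s h1 h2 hs
      have := (h1 hs).sub (h2 hs)
      rw [add_sub_add_right_eq_sub, ← map_sub] at this
      exact this) (by
      refine Eventually.of_forall fun s _ ↦ ?_
      rw [add_zero]
      exact A.le_opNorm _) (by simp [h])
  rw [gronwallBound_ε0_δ0] at key
  exact sub_eq_zero.mp (norm_le_zero_iff.mp key)

/-! ### Norms, quadratic forms and eigenvalues -/

section NormLemmas

open scoped Matrix.Norms.L2Operator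

lemma norm2_nonneg {p q : ℕ} (M : Matrix (Fin p) (Fin q) ℝ) : 0 ≤ norm2 M := by
  unfold norm2; exact norm_nonneg _

lemma norm_toEuclideanLin_le {p q : ℕ} (M : Matrix (Fin p) (Fin q) ℝ) (x : Vec q) :
    ‖toEuclideanLin M x‖ ≤ norm2 M * ‖x‖ := by
  unfold norm2
  exact l2_opNorm_mulVec M x

lemma norm2_le_of_forall {p q : ℕ} (M : Matrix (Fin p) (Fin q) ℝ) {C : ℝ} (hC : 0 ≤ C)
    (h : ∀ x : Vec q, ‖toEuclideanLin M x‖ ≤ C * ‖x‖) : norm2 M ≤ C := by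
  unfold norm2
  rw [l2_opNorm_def]
  exact ContinuousLinearMap.opNorm_le_bound _ hC h

lemma norm2_transpose {p q : ℕ} (M : Matrix (Fin p) (Fin q) ℝ) : norm2 Mᵀ = norm2 M := by
  unfold norm2
  rw [← l2_opNorm_conjTranspose M, conjTranspose_eq_transpose_of_trivial]

lemma norm2_sub_le {p q : ℕ} (M N : Matrix (Fin p) (Fin q) ℝ) :
    norm2 (M - N) ≤ norm2 M + norm2 N := by
  unfold norm2; exact norm_sub_le _ _

lemma norm2_mul_le {p q r : ℕ} (M : Matrix (Fin p) (Fin q) ℝ) (N : Matrix (Fin q) (Fin r) ℝ) :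
    norm2 (M * N) ≤ norm2 M * norm2 N := by
  unfold norm2; exact l2_opNorm_mul _ _

end NormLemmas

lemma norm_sq_eq_dotProduct {n : ℕ} (x : Vec n) : ‖x‖ ^ 2 = x.ofLp ⬝ᵥ x.ofLp := by
  rw [← real_inner_self_eq_norm_sq, EuclideanSpace.inner_eq_star_dotProduct, star_trivial]

lemma inner_toEuclideanLin {n : ℕ} (M : Matrix (Fin n) (Fin n) ℝ) (x y : Vec n) :
    inner ℝ x (toEuclideanLin M y) = x.ofLp ⬝ᵥ (M *ᵥ y.ofLp) := by
  rw [EuclideanSpace.inner_eq_star_dotProduct, star_trivial, dotProduct_comm]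
  rfl

lemma dotProduct_mulVec_eq {p q : Type*} [Fintype p] [Fintype q] (M : Matrix p q ℝ)
    (v : p → ℝ) (w : q → ℝ) : v ⬝ᵥ (M *ᵥ w) = (Mᵀ *ᵥ v) ⬝ᵥ w := by
  rw [dotProduct_mulVec, mulVec_transpose]

lemma dotProduct_self_nonneg_real {p : Type*} [Fintype p] (v : p → ℝ) : 0 ≤ v ⬝ᵥ v :=
  Finset.sum_nonneg fun _ _ ↦ mul_self_nonneg _

/-- Young's inequality. -/
lemma neg_two_mul_dotProduct_le {p : Type*} [Fintype p] (v w : p → ℝ) {c : ℝ} (hc : 0 < c) :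
    -2 * (v ⬝ᵥ w) ≤ c * (v ⬝ᵥ v) + c⁻¹ * (w ⬝ᵥ w) := by
  have h := dotProduct_self_nonneg_real (c • v + w)
  simp only [add_dotProduct, dotProduct_add, smul_dotProduct, dotProduct_smul, smul_eq_mul,
    dotProduct_comm w v] at h
  have h2 : c * (v ⬝ᵥ v) + c⁻¹ * (w ⬝ᵥ w) + 2 * (v ⬝ᵥ w) =
      c⁻¹ * (c * (c * (v ⬝ᵥ v)) + c * (v ⬝ᵥ w) + (c * (v ⬝ᵥ w) + w ⬝ᵥ w)) := by
    field_simp; ring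
  have h3 := mul_nonneg (inv_pos.mpr hc).le h
  linarith

lemma spectrum_finite {n : ℕ} {M : Matrix (Fin n) (Fin n) ℝ} (hM : M.IsHermitian) :
    (spectrum ℝ M).Finite := by
  rw [hM.spectrum_real_eq_range_eigenvalues]
  exact finite_range _

lemma minEig_mul_le {n : ℕ} {M : Matrix (Fin n) (Fin n) ℝ} (hM : M.IsHermitian)
    (v : Fin n → ℝ) : minEig M * (v ⬝ᵥ v) ≤ v ⬝ᵥ (M *ᵥ v) := by
  have hH : (M - minEig M • (1 : Matrix (Fin n) (Fin n) ℝ)).IsHermitian :=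
    hM.sub (by simp [IsHermitian])
  have hP : (M - minEig M • (1 : Matrix (Fin n) (Fin n) ℝ)).PosSemidef := by
    rw [hH.posSemidef_iff_eigenvalues_nonneg]
    intro i
    have h1 : hH.eigenvalues i ∈ spectrum ℝ (M - minEig M • (1 : Matrix (Fin n) (Fin n) ℝ)) := by
      rw [hH.spectrum_real_eq_range_eigenvalues]; exact mem_range_self i
    have h2 : minEig M + hH.eigenvalues i ∈ spectrum ℝ M := by
      have := (spectrum.add_mem_add_iff (R := ℝ) (s := minEig M)).mpr h1
      rwa [Algebra.algebraMap_eq_smul_one, add_sub_cancel, add_comm] at this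
    have h3 : minEig M ≤ minEig M + hH.eigenvalues i :=
      csInf_le (spectrum_finite hM).bddBelow h2
    simpa using h3
  have := hP.dotProduct_mulVec_nonneg v
  simp only [star_trivial, sub_mulVec, smul_mulVec, one_mulVec, dotProduct_sub, dotProduct_smul,
    smul_eq_mul] at this
  linarith

lemma minEig_pos {n : ℕ} (hn : 0 < n) {M : Matrix (Fin n) (Fin n) ℝ} (hM : M.PosDef) :
    0 < minEig M := by
  have hne : (spectrum ℝ M).Nonempty := by
    rw [hM.1.spectrum_real_eq_range_eigenvalues]
    have : Nonempty (Fin n) := ⟨⟨0, hn⟩⟩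
    exact range_nonempty _
  have hmem := hne.csInf_mem (spectrum_finite hM.1)
  rw [hM.1.spectrum_real_eq_range_eigenvalues] at hmem
  obtain ⟨i, hi⟩ := hmem
  unfold minEig
  rw [hM.1.spectrum_real_eq_range_eigenvalues, ← hi]
  exact hM.eigenvalues_pos i

/-! ### Consequences of the matrix inequalities -/

section Data

variable {n m T s : ℕ} {A : Matrix (Fin n) (Fin n) ℝ} {B : Matrix (Fin n) (Fin m) ℝ}
  {U0 : Matrix (Fin m) (Fin T) ℝ} {X0 X1 D0 : Matrix (Fin n) (Fin T) ℝ}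
  {Δ : Matrix (Fin n) (Fin s) ℝ} {K : Matrix (Fin m) (Fin n) ℝ}

lemma dotProduct_noise_le (hD0 : (Δ * Δᵀ - D0 * D0ᵀ).PosSemidef) (v : Fin n → ℝ) :
    (D0ᵀ *ᵥ v) ⬝ᵥ (D0ᵀ *ᵥ v) ≤ (Δᵀ *ᵥ v) ⬝ᵥ (Δᵀ *ᵥ v) := by
  have h := hD0.dotProduct_mulVec_nonneg v
  simp only [star_trivial, sub_mulVec, ← mulVec_mulVec, dotProduct_sub] at h
  rw [dotProduct_mulVec_eq, dotProduct_mulVec_eq D0] at h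
  linarith

lemma norm2_noise_le (hD0 : (Δ * Δᵀ - D0 * D0ᵀ).PosSemidef) : norm2 D0 ≤ norm2 Δ := by
  rw [← norm2_transpose D0, ← norm2_transpose Δ]
  refine norm2_le_of_forall _ (norm2_nonneg _) fun x ↦ ?_
  refine le_trans ?_ (norm_toEuclideanLin_le _ x)
  rw [← abs_of_nonneg (norm_nonneg (toEuclideanLin D0ᵀ x)),
    ← abs_of_nonneg (norm_nonneg (toEuclideanLin Δᵀ x)), ← sq_le_sq, norm_sq_eq_dotProduct,
    norm_sq_eq_dotProduct]
  exact dotProduct_noise_le hD0 x.ofLp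

lemma dataBound_nonneg (M : Matrix (Fin T) (Fin n) ℝ) : 0 ≤ dataBound X1 Δ M :=
  add_nonneg (norm2_nonneg _) (mul_nonneg (norm2_nonneg _) (norm2_nonneg _))

lemma norm2_le_dataBound (hD0 : (Δ * Δᵀ - D0 * D0ᵀ).PosSemidef) (M : Matrix (Fin T) (Fin n) ℝ) :
    norm2 (X1 * M - D0 * M) ≤ dataBound X1 Δ M := by
  refine (norm2_sub_le _ _).trans (add_le_add le_rfl ((norm2_mul_le _ _).trans ?_))
  exact mul_le_mul_of_nonneg_right (norm2_noise_le hD0) (norm2_nonneg _)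

/-- Every combination of the columns of the data matrices reproduces the plant up to the noise. -/
lemma plant_eq_of_data (hdata : X1 = A * X0 + B * U0 + D0) {k : ℕ} {M : Matrix (Fin T) (Fin k) ℝ}
    {N : Matrix (Fin m) (Fin k) ℝ} {R : Matrix (Fin n) (Fin k) ℝ}
    (hM : fromRows U0 X0 * M = fromRows N R) : A * R + B * N = X1 * M - D0 * M := by
  rw [fromRows_mul, fromRows_ext_iff] at hM
  obtain ⟨hU, hX⟩ := hM
  rw [hdata, ← hU, ← hX, Matrix.add_mul, Matrix.add_mul, Matrix.mul_assoc, Matrix.mul_assoc]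
  abel

/-- `V(x) = xᵀ S x` decreases along the undisturbed closed loop with continuous transmissions. With
`v = S x` the derivative is `2 vᵀ (X₁ - D₀) Y v`, and the noise term is absorbed by the
completion of squares that the controller inequality encodes through its Schur complement. -/
lemma closedLoop_form_le (hdata : X1 = A * X0 + B * U0 + D0)
    (hD0 : (Δ * Δᵀ - D0 * D0ᵀ).PosSemidef) {Ω : Matrix (Fin n) (Fin n) ℝ} {ε₀ : ℝ} (hε₀ : 0 < ε₀)
    {Y : Matrix (Fin T) (Fin n) ℝ} (hY : ControllerLMI X0 X1 Δ Ω ε₀ Y)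
    (v : Fin n → ℝ) :
    2 * (v ⬝ᵥ ((X0 * Y)⁻¹ *ᵥ ((A + B * (U0 * Y * (X0 * Y)⁻¹)) *ᵥ v))) ≤
      -(v ⬝ᵥ (((X0 * Y)⁻¹ * Ω * (X0 * Y)⁻¹) *ᵥ v)) := by
  obtain ⟨hneg, hpos⟩ := hY
  set S := (X0 * Y)⁻¹ with hS
  have hSsymm : Sᵀ = S := by
    have := hpos.inv.1
    rwa [IsHermitian, conjTranspose_eq_transpose_of_trivial] at this
  have hPS : (X0 * Y) * S = 1 :=
    mul_nonsing_inv _ ((Matrix.isUnit_iff_isUnit_det _).mp hpos.isUnit)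
  set w := S *ᵥ v with hw
  have h1 : (A + B * (U0 * Y * S)) *ᵥ v = (X1 * Y) *ᵥ w - (D0 * Y) *ᵥ w := by
    have : A + B * (U0 * Y * S) = (X1 * Y - D0 * Y) * S := by
      have h2 : A * (X0 * Y * S) + B * (U0 * Y * S) = X1 * (Y * S) - D0 * (Y * S) := by
        rw [hdata, Matrix.add_mul, Matrix.add_mul]
        simp only [Matrix.mul_assoc]
        abel
      rw [hPS, Matrix.mul_one] at h2
      rw [h2, Matrix.sub_mul, Matrix.mul_assoc, Matrix.mul_assoc]
    rw [this, ← mulVec_mulVec, sub_mulVec]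
  have h3 : v ⬝ᵥ (S *ᵥ ((A + B * (U0 * Y * S)) *ᵥ v)) =
      w ⬝ᵥ ((X1 * Y) *ᵥ w) - (D0ᵀ *ᵥ w) ⬝ᵥ (Y *ᵥ w) := by
    rw [dotProduct_mulVec_eq, hSsymm, h1, dotProduct_sub, ← mulVec_mulVec w D0 Y,
      dotProduct_mulVec_eq D0]
  have h4 : v ⬝ᵥ ((S * Ω * S) *ᵥ v) = w ⬝ᵥ (Ω *ᵥ w) := by
    rw [← mulVec_mulVec, ← mulVec_mulVec, dotProduct_mulVec_eq, hSsymm]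
  have h5 := hneg.posSemidef.dotProduct_mulVec_nonneg (Sum.elim w (ε₀⁻¹ • (Y *ᵥ w)))
  have h6 : w ⬝ᵥ ((X1 * Y)ᵀ *ᵥ w) = w ⬝ᵥ ((X1 * Y) *ᵥ w) := by
    rw [dotProduct_mulVec_eq, transpose_transpose, dotProduct_comm]
  have h7 : w ⬝ᵥ ((Δ * Δᵀ) *ᵥ w) = (Δᵀ *ᵥ w) ⬝ᵥ (Δᵀ *ᵥ w) := by
    rw [← mulVec_mulVec, dotProduct_mulVec_eq]
  have h8 : w ⬝ᵥ (Yᵀ *ᵥ (Y *ᵥ w)) = (Y *ᵥ w) ⬝ᵥ (Y *ᵥ w) := by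
    rw [dotProduct_mulVec_eq, transpose_transpose]
  simp only [star_trivial, neg_mulVec, dotProduct_neg, fromBlocks_mulVec, add_mulVec,
    smul_mulVec, mulVec_smul, one_mulVec, sumElim_dotProduct_sumElim, dotProduct_add,
    dotProduct_smul, smul_dotProduct, smul_eq_mul, Sum.elim_comp_inl, Sum.elim_comp_inr,
    h6, h7, h8] at h5
  have h9 := neg_two_mul_dotProduct_le (D0ᵀ *ᵥ w) (Y *ᵥ w) hε₀
  have h10 := mul_le_mul_of_nonneg_left (dotProduct_noise_le hD0 w) hε₀.le
  have h11 : ε₀ * (ε₀⁻¹ * (Y *ᵥ w ⬝ᵥ Y *ᵥ w)) = Y *ᵥ w ⬝ᵥ Y *ᵥ w := by field_simp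
  have h12 : ε₀⁻¹ * (ε₀ * (ε₀⁻¹ * (Y *ᵥ w ⬝ᵥ Y *ᵥ w))) = ε₀⁻¹ * (Y *ᵥ w ⬝ᵥ Y *ᵥ w) := by
    rw [h11]
  rw [h3, h4]
  nlinarith

/-- The triggering matrix dominates, up to half of the decrease of `V`, the effect of the sampling
error on `V`. -/
lemma sampled_form_le_quad (hD0 : (Δ * Δᵀ - D0 * D0ᵀ).PosSemidef)
    {Ω S : Matrix (Fin n) (Fin n) ℝ} (hS : Sᵀ = S) {L : Matrix (Fin T) (Fin n) ℝ}
    {μ ε σ₂ : ℝ} (hε : 0 < ε) {Ψ : Matrix (Fin n ⊕ Fin n) (Fin n ⊕ Fin n) ℝ}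
    (hTrig : TriggerLMI X1 Δ Ω S L μ ε σ₂ Ψ) (x e : Vec n) :
    2 * μ * (x.ofLp ⬝ᵥ (S *ᵥ ((X1 * L - D0 * L) *ᵥ e.ofLp))) ≤
      quad Ψ x e + μ / 2 * (x.ofLp ⬝ᵥ ((S * Ω * S) *ᵥ x.ofLp)) := by
  set p := x.ofLp
  set q := e.ofLp
  have h1 : p ⬝ᵥ (S *ᵥ ((X1 * L - D0 * L) *ᵥ q)) =
      p ⬝ᵥ ((S * X1 * L) *ᵥ q) - (D0ᵀ *ᵥ (S *ᵥ p)) ⬝ᵥ (L *ᵥ q) := by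
    rw [sub_mulVec, mulVec_sub, dotProduct_sub, ← mulVec_mulVec q D0, dotProduct_mulVec_eq S p
      (D0 *ᵥ _), dotProduct_mulVec_eq D0, hS]
    simp only [mulVec_mulVec, Matrix.mul_assoc]
  set g := Δᵀ *ᵥ (S *ᵥ p) with hg
  have h2 := hTrig.1.dotProduct_mulVec_nonneg (Sum.elim (Sum.elim p q) ((μ / ε) • g))
  have h3 : p ⬝ᵥ ((S * Δ) *ᵥ g) = g ⬝ᵥ g := by
    rw [← mulVec_mulVec, dotProduct_mulVec_eq, hS, dotProduct_mulVec_eq]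
  have h4 : g ⬝ᵥ ((S * Δ)ᵀ *ᵥ p) = g ⬝ᵥ g := by
    rw [dotProduct_mulVec_eq, transpose_transpose, dotProduct_comm, h3]
  have h5 : q ⬝ᵥ ((S * X1 * L)ᵀ *ᵥ p) = p ⬝ᵥ ((S * X1 * L) *ᵥ q) := by
    rw [dotProduct_mulVec_eq, transpose_transpose, dotProduct_comm]
  have h6 : q ⬝ᵥ ((Lᵀ * L) *ᵥ q) = (L *ᵥ q) ⬝ᵥ (L *ᵥ q) := by
    rw [← mulVec_mulVec, dotProduct_mulVec_eq, transpose_transpose]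
  simp only [trigLHS, star_trivial, sub_mulVec, dotProduct_sub, fromBlocks_mulVec,
    neg_mulVec, dotProduct_neg, smul_mulVec, mulVec_smul, one_mulVec, zero_mulVec,
    sumElim_dotProduct_sumElim, dotProduct_add, dotProduct_smul, smul_dotProduct, smul_eq_mul,
    Sum.elim_comp_inl, Sum.elim_comp_inr, transpose_smul, transpose_fromRows, fromRows_mulVec,
    fromCols_mulVec, transpose_zero, dotProduct_zero, add_zero, h3, h4, h5, h6] at h2
  have h7 := neg_two_mul_dotProduct_le (μ • (D0ᵀ *ᵥ (S *ᵥ p))) (L *ᵥ q) (inv_pos.mpr hε)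
  simp only [smul_dotProduct, dotProduct_smul, smul_eq_mul, inv_inv] at h7
  have h8 := mul_le_mul_of_nonneg_left (dotProduct_noise_le hD0 (S *ᵥ p))
    (mul_nonneg (inv_pos.mpr hε).le (mul_self_nonneg μ))
  rw [← hg] at h8
  have h9 : ε * (μ / ε * (μ / ε * (g ⬝ᵥ g))) = ε⁻¹ * (μ * μ) * (g ⬝ᵥ g) := by field_simp
  have h10 : μ / ε * (μ * (g ⬝ᵥ g)) = ε⁻¹ * (μ * μ) * (g ⬝ᵥ g) := by field_simp
  have h11 : quad Ψ x e = Sum.elim p q ⬝ᵥ (Ψ *ᵥ Sum.elim p q) := rfl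
  rw [h1, h11]
  nlinarith

lemma quad_le {Ω S : Matrix (Fin n) (Fin n) ℝ}
    {L : Matrix (Fin T) (Fin n) ℝ} {μ ε σ₂ : ℝ} {Ψ : Matrix (Fin n ⊕ Fin n) (Fin n ⊕ Fin n) ℝ}
    (hTrig : TriggerLMI X1 Δ Ω S L μ ε σ₂ Ψ) (x e : Vec n) :
    quad Ψ x e ≤ ‖e‖ ^ 2 - 2 * σ₂ ^ 2 * ‖x‖ ^ 2 := by
  have h := hTrig.2.dotProduct_mulVec_nonneg (Sum.elim x.ofLp e.ofLp)
  simp only [PsiBar, star_trivial, sub_mulVec, dotProduct_sub, fromBlocks_mulVec,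
    neg_mulVec, smul_mulVec, one_mulVec, zero_mulVec, add_zero, zero_add,
    sumElim_dotProduct_sumElim, dotProduct_neg, dotProduct_smul, smul_eq_mul,
    Sum.elim_comp_inl, Sum.elim_comp_inr] at h
  rw [norm_sq_eq_dotProduct, norm_sq_eq_dotProduct]
  unfold quad
  linarith

/-- Without the triggering matrix, the effect of the sampling error on `V` is controlled by the
data-based constant `ω₂`. -/
lemma sampled_form_le_omega2 (hD0 : (Δ * Δᵀ - D0 * D0ᵀ).PosSemidef)
    (S : Matrix (Fin n) (Fin n) ℝ) (L : Matrix (Fin T) (Fin n) ℝ) (x e : Vec n) :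
    2 * (x.ofLp ⬝ᵥ (S *ᵥ ((X1 * L - D0 * L) *ᵥ e.ofLp))) ≤
      omega2 X1 Δ S L * ‖x‖ * ‖e‖ := by
  have h1 : x.ofLp ⬝ᵥ (S *ᵥ ((X1 * L - D0 * L) *ᵥ e.ofLp)) =
      inner ℝ x (toEuclideanLin (S * X1 * L - S * (D0 * L)) e) := by
    rw [inner_toEuclideanLin, mulVec_mulVec, Matrix.mul_sub, Matrix.mul_assoc S X1]
  have h2 : norm2 (S * X1 * L - S * (D0 * L)) ≤
      norm2 (S * X1 * L) + norm2 S * (norm2 Δ * norm2 L) := by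
    refine (norm2_sub_le _ _).trans (add_le_add le_rfl ((norm2_mul_le _ _).trans ?_))
    refine mul_le_mul_of_nonneg_left ((norm2_mul_le _ _).trans ?_) (norm2_nonneg _)
    exact mul_le_mul_of_nonneg_right (norm2_noise_le hD0) (norm2_nonneg _)
  have h3 := (norm_toEuclideanLin_le (S * X1 * L - S * (D0 * L)) e).trans
    (mul_le_mul_of_nonneg_right h2 (norm_nonneg e))
  have h4 := (real_inner_le_norm x (toEuclideanLin (S * X1 * L - S * (D0 * L)) e)).trans
    (mul_le_mul_of_nonneg_left h3 (norm_nonneg x))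
  rw [h1]
  unfold omega2
  linarith

end Data

/-! ### Solutions between two transmissions -/

lemma psi_eq_zero {τ s c : ℝ} (h : c ∈ psi τ s) (hτ : τ ≠ 0) (hs : s < τ) : c = 0 := by
  simpa [psi, hτ, hs] using h

lemma psi_eq_one {τ s c : ℝ} (h : c ∈ psi τ s) (hs : τ < s) : c = 1 := by
  unfold psi at h
  split_ifs at h with h1 h2 h3
  · exact h
  · linarith
  · linarith
  · exact h

lemma one_mem_psi {τ s : ℝ} (hs : τ < s) : (1 : ℝ) ∈ psi τ s := by
  unfold psi
  split_ifs with h1 h2 h3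
  · rfl
  · linarith
  · linarith
  · rfl

lemma zero_mem_psi {τ s : ℝ} (hτ : τ ≠ 0) (hs : s < τ) : (0 : ℝ) ∈ psi τ s := by
  simp [psi, hτ, hs]

lemma continuous_quad {n : ℕ} (Ψ : Matrix (Fin n ⊕ Fin n) (Fin n ⊕ Fin n) ℝ) :
    Continuous fun z : Vec n × Vec n ↦ quad Ψ z.1 z.2 := by
  have h : Continuous fun z : Vec n × Vec n ↦ (Sum.elim z.1.ofLp z.2.ofLp : Fin n ⊕ Fin n → ℝ) := by
    refine continuous_pi fun i ↦ ?_
    rcases i with i | i <;> simp only [Sum.elim_inl, Sum.elim_inr] <;> fun_prop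
  unfold quad
  exact h.dotProduct (continuous_const.matrix_mulVec h)

section Solution

variable {n m : ℕ} {P : Loop n m} {d : ℝ → Vec n} {φ : Arc n}

lemma IsSolution.add_le_t_succ (h : IsSolution P d φ) {k : ℕ} (hk : k + 1 ∈ φ.idx) :
    φ.t k + P.τ ≤ φ.t (k + 1) :=
  (h.next k (h.idx_pred k hk) hk).1.2.1

lemma IsSolution.t_succ_mem_flow (h : IsSolution P d φ) (hτ : 0 ≤ P.τ) {k : ℕ}
    (hk : k + 1 ∈ φ.idx) : φ.t (k + 1) ∈ φ.flow k :=
  ⟨h.t_mem _ hk, by linarith [h.add_le_t_succ hk], fun _ ↦ le_rfl⟩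

lemma IsSolution.Icc_subset_flow (h : IsSolution P d φ) {k : ℕ} (hk : k ∈ φ.idx) {s : ℝ}
    (hs : s ∈ φ.flow k) : Icc (φ.t k) s ⊆ φ.flow k := fun _ hu ↦
  ⟨h.ordConnected.out (h.t_mem k hk) hs.1 hu, hu.1, fun hk1 ↦ hu.2.trans (hs.2.2 hk1)⟩

lemma IsSolution.deriv_x_Icc (h : IsSolution P d φ) {k : ℕ} (hk : k ∈ φ.idx) {s : ℝ}
    (hs : s ∈ φ.flow k) : ∀ᵐ u, u ∈ Icc (φ.t k) s →
      HasDerivAt φ.x (P.field (φ.x u) (φ.e k u) (d u)) u := by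
  filter_upwards [h.deriv_x k hk] with u h1 hu using h1 (h.Icc_subset_flow hk hs hu)

/-- Up to a null set, the auxiliary variable decays freely during the dwell time and is driven by
the triggering form afterwards. -/
lemma IsSolution.deriv_η_Icc (h : IsSolution P d φ) {k : ℕ} (hk : k ∈ φ.idx) {s : ℝ}
    (hs : s ∈ φ.flow k) : ∀ᵐ u, u ∈ Icc (φ.t k) s → u ≠ φ.t k + P.τ ∧
      HasDerivAt φ.η (-P.lam * φ.η u -
        (if φ.t k + P.τ < u then quad P.Ψ (φ.x u) (φ.e k u) - P.ν else 0)) u := by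
  filter_upwards [h.deriv_η k hk, ae_ne (φ.t k + P.τ)] with u h1 h2 hu
  refine ⟨h2, ?_⟩
  obtain ⟨c, hc, hd⟩ := h1 (h.Icc_subset_flow hk hs hu)
  split_ifs with h3
  · rw [psi_eq_one hc (by linarith), one_mul] at hd
    exact hd
  · have h4 : u < φ.t k + P.τ := lt_of_le_of_ne (not_lt.mp h3) h2
    have h5 : P.τ ≠ 0 := by
      intro h0; rw [h0] at h4; linarith [hu.1]
    rw [psi_eq_zero hc h5 (by linarith), zero_mul] at hd
    exact hd

lemma IsSolution.not_trig (h : IsSolution P d φ) {k : ℕ} (hk : k ∈ φ.idx) {s u : ℝ}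
    (hs : s ∈ φ.flow k) (hu : φ.t k ≤ u) (hu1 : φ.t k + P.τ ≤ u) (hus : u < s) :
    ¬ P.Trig (φ.x u) (φ.e k u) (φ.η u) := by
  intro htrig
  have hmem : u ∈ φ.trigSet P k := ⟨(h.Icc_subset_flow hk hs ⟨hu, hus.le⟩).1, hu1, htrig⟩
  by_cases hk1 : k + 1 ∈ φ.idx
  · linarith [(h.next k hk hk1).2 hmem, hs.2.2 hk1]
  · rw [h.last k hk hk1] at hmem
    exact hmem

/-- The auxiliary variable stays nonnegative: wherever it is negative and no transmission is
triggered, it cannot decrease. -/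
lemma aux_nonneg (P : Loop n m) (hlam : 0 < P.lam) (hθ : 0 ≤ P.θ) {x e : ℝ → Vec n} {η : ℝ → ℝ}
    {a s : ℝ} (has : a ≤ s) (hac : AbsolutelyContinuousOnInterval η a s)
    (hd : ∀ᵐ u, u ∈ Icc a s → HasDerivAt η (-P.lam * η u -
        (if a + P.τ < u then quad P.Ψ (x u) (e u) - P.ν else 0)) u)
    (hnt : ∀ u, a ≤ u → a + P.τ ≤ u → u < s → ¬ P.Trig (x u) (e u) (η u))
    (h0 : 0 ≤ η a) : 0 ≤ η s := by
  by_contra! hneg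
  have hcont : ContinuousOn η (Icc a s) := by simpa [uIcc_of_le has] using hac.continuousOn
  set Z := Icc a s ∩ η ⁻¹' Ici 0 with hZ
  have hZc : IsCompact Z :=
    isCompact_Icc.of_isClosed_subset (hcont.preimage_isClosed_of_isClosed isClosed_Icc isClosed_Ici)
      inter_subset_left
  obtain ⟨u₀, hu₀, hmax⟩ := hZc.exists_isGreatest ⟨a, ⟨le_rfl, has⟩, h0⟩
  have hη₀ : 0 ≤ η u₀ := hu₀.2
  have hlt : ∀ u ∈ Icc a s, u₀ < u → η u < 0 := by
    intro u hu hlt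
    by_contra! hcon
    exact hlt.not_ge (hmax ⟨hu, hcon⟩)
  have key := sub_le_of_ae_deriv_le (f := fun u ↦ -η u) (C := 0) hu₀.1.2
    (absolutelyContinuous_mono hac.fun_neg hu₀.1.1 hu₀.1.2 le_rfl)
    (f' := fun u ↦ -(-P.lam * η u -
        (if a + P.τ < u then quad P.Ψ (x u) (e u) - P.ν else 0)))
    (by
      filter_upwards [hd] with u h1 hu
      exact (h1 ⟨hu₀.1.1.trans hu.1, hu.2⟩).neg)
    (by
      filter_upwards [ae_ne u₀, ae_ne s] with u hu₁' hu₂' hu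
      have hu1 : u₀ < u := lt_of_le_of_ne hu.1 hu₁'.symm
      have hu2 : u < s := lt_of_le_of_ne hu.2 hu₂'
      have huI : u ∈ Icc a s := ⟨hu₀.1.1.trans hu.1, hu.2⟩
      have hη := hlt u huI hu1
      have hlη : P.lam * η u < 0 := mul_neg_of_pos_of_neg hlam hη
      split_ifs with h3
      · have hnt := hnt u huI.1 h3.le hu2
        unfold Loop.Trig at hnt
        rcases hθ.eq_or_lt with hθ0 | hθ0
        · rw [← hθ0, zero_mul, sub_zero] at hnt
          push Not at hnt
          linarith [(hnt hη.le).2.2]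
        · by_contra! hcon
          have hq : 0 ≤ quad P.Ψ (x u) (e u) - P.ν := by linarith
          refine hnt ⟨by nlinarith, fun h1 ↦ by linarith⟩
      · linarith)
  linarith

lemma IsSolution.η_nonneg_flow (h : IsSolution P d φ) (hlam : 0 < P.lam) (hθ : 0 ≤ P.θ)
    {k : ℕ} (hk : k ∈ φ.idx) (h0 : 0 ≤ φ.η (φ.t k)) {s : ℝ}
    (hs : s ∈ φ.flow k) : 0 ≤ φ.η s := by
  refine aux_nonneg P hlam hθ hs.2.1 (h.ac_η k hk s hs) ?_
    (fun u hu hu1 hus ↦ h.not_trig hk hs hu hu1 hus) h0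
  filter_upwards [h.deriv_η_Icc hk hs] with u h1 hu using (h1 hu).2

lemma IsSolution.η_t_nonneg (h : IsSolution P d φ) (hlam : 0 < P.lam) (hθ : 0 ≤ P.θ)
    (hτ : 0 ≤ P.τ) (k : ℕ) (hk : k ∈ φ.idx) : 0 ≤ φ.η (φ.t k) := by
  induction k with
  | zero => rw [h.t_zero]; exact h.η_init
  | succ k ih =>
    have hk' := h.idx_pred k hk
    exact h.η_nonneg_flow hlam hθ hk' (ih hk') (h.t_succ_mem_flow hτ hk)

lemma IsSolution.η_nonneg (h : IsSolution P d φ) (hlam : 0 < P.lam) (hθ : 0 ≤ P.θ)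
    (hτ : 0 ≤ P.τ) {s : ℝ} (hs : s ∈ φ.dom) : 0 ≤ φ.η s := by
  obtain ⟨k, hk, hsk⟩ := h.cover s hs
  exact h.η_nonneg_flow hlam hθ hk (h.η_t_nonneg hlam hθ hτ k hk) hsk

/-! ### The minimum inter-event time -/

lemma Loop.Trig.le_quad {x e : Vec n} {η : ℝ} (h : P.Trig x e η) (hη : 0 ≤ η) (hθ : 0 ≤ P.θ)
    (hc : 0 < P.θ ∨ P.τ = 0) : P.ν ≤ quad P.Ψ x e := by
  rcases hθ.eq_or_lt with h0 | h0
  · have hτ : P.τ = 0 := hc.resolve_left (by rw [← h0]; exact lt_irrefl _)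
    have h1 := h.1
    rw [← h0, zero_mul, sub_zero] at h1
    have h2 := h.2 h0.symm hτ
    have h3 : η = 0 := le_antisymm h1 hη
    rw [h3, mul_zero] at h2
    linarith
  · by_contra! hcon
    have := mul_neg_of_pos_of_neg h0 (sub_neg.mpr hcon)
    linarith [h.1]

/-- When the triggering form exceeds `ν`, the sampling error is large relative to the state:
`(σ |x| + √(ν/2))² ≤ 2 σ² |x|² + ν`. -/
lemma le_norm_error_of_le_quad {Ψ : Matrix (Fin n ⊕ Fin n) (Fin n ⊕ Fin n) ℝ} {σ ν : ℝ}
    (hσ : 0 < σ) (hν : 0 ≤ ν) {x e : Vec n}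
    (hq : quad Ψ x e ≤ ‖e‖ ^ 2 - 2 * σ ^ 2 * ‖x‖ ^ 2) (h : ν ≤ quad Ψ x e) :
    σ * (‖x‖ + Real.sqrt (ν / 2) / σ) ≤ ‖e‖ := by
  have h1 : σ * (‖x‖ + Real.sqrt (ν / 2) / σ) = σ * ‖x‖ + Real.sqrt (ν / 2) := by
    field_simp
  have h2 := Real.sq_sqrt (show 0 ≤ ν / 2 by linarith)
  rw [h1]
  refine abs_le_of_sq_le_sq' ?_ (norm_nonneg e) |>.2
  nlinarith [sq_nonneg (σ * ‖x‖ - Real.sqrt (ν / 2))]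

/-- The part of the inter-event time that does not come from the dwell time. -/
lemma IsSolution.inter_event_time (h : IsSolution P d φ) (hlam : 0 < P.lam) (hθ : 0 ≤ P.θ)
    (hτ : 0 ≤ P.τ) (hc : 0 < P.θ ∨ P.τ = 0) {σ cΦ cL D α : ℝ} (hσ : 0 < σ) (hν : 0 < P.ν)
    (hq : ∀ x e : Vec n, quad P.Ψ x e ≤ ‖e‖ ^ 2 - 2 * σ ^ 2 * ‖x‖ ^ 2)
    (hΦ : norm2 (P.A + P.B * P.K) ≤ cΦ) (hL : norm2 (P.B * P.K) ≤ cL)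
    (hD : ∀ s, 0 ≤ s → ‖d s‖ ≤ D) (hα1 : cΦ ≤ α) (hα2 : cL ≤ α)
    (hα3 : σ * D / Real.sqrt (P.ν / 2) ≤ α) {k : ℕ} (hk1 : k + 1 ∈ φ.idx) :
    σ / (1 + σ) ≤ α * (φ.t (k + 1) - φ.t k) := by
  have hk := h.idx_pred k hk1
  have hs := h.t_succ_mem_flow hτ hk1
  have hrt : 0 < Real.sqrt (P.ν / 2) := Real.sqrt_pos.mpr (by linarith)
  set w := Real.sqrt (P.ν / 2) / σ with hw
  have hwpos : 0 < w := by positivity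
  have hDw : D ≤ α * w := by
    rw [div_le_iff₀ hrt] at hα3
    rw [hw, ← mul_div_assoc, le_div_iff₀ hσ]
    linarith
  have h1 := relative_error_le (α := α) hs.2.1 hwpos (h.ac_x k hk _ hs) (h.deriv_x_Icc hk hs) (by
    refine Eventually.of_forall fun s hsI ↦ ?_
    have hs0 : 0 ≤ s := h.dom_nonneg (h.Icc_subset_flow hk hs hsI).1
    have e1 := (norm_toEuclideanLin_le (P.A + P.B * P.K) (φ.x s)).trans
      (mul_le_mul_of_nonneg_right (hΦ.trans hα1) (norm_nonneg _))
    have e2 := (norm_toEuclideanLin_le (P.B * P.K) (φ.e k s)).trans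
      (mul_le_mul_of_nonneg_right (hL.trans hα2) (norm_nonneg _))
    have e3 := (hD s hs0).trans hDw
    unfold Loop.field
    refine (norm_add₃_le).trans ?_
    have e4 : ‖φ.e k s‖ = ‖φ.x (φ.t k) - φ.x s‖ := rfl
    rw [e4] at e2
    linarith)
  refine le_trans ?_ h1
  have htrig := (h.next k hk hk1).1.2.2
  have h2 := le_norm_error_of_le_quad hσ hν.le (hq _ _)
    (htrig.le_quad (h.η_nonneg hlam hθ hτ hs.1) hθ hc)
  have h3 : ‖φ.e k (φ.t (k + 1))‖ = ‖φ.x (φ.t k) - φ.x (φ.t (k + 1))‖ := rfl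
  rw [h3, ← hw] at h2
  rw [div_le_div_iff₀ (by positivity) (by positivity)]
  nlinarith

end Solution

/-! ### The sampling error during the dwell time -/

lemma tauD_pos {cA cΦ σ : ℝ} (hA : 0 ≤ cA) (hσ : 0 < σ) : 0 < tauD cA cΦ σ := by
  have hmax : 0 < max cΦ 1 := lt_max_of_lt_right one_pos
  unfold tauD
  split_ifs with h
  · positivity
  · have hA' : 0 < cA := lt_of_le_of_ne hA (Ne.symm h)
    have h1 : 0 < σ / (1 + σ) * (cA / max cΦ 1) := by positivity
    exact mul_pos (by positivity) (Real.log_pos (by linarith))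

/-- The dwell time is the time that the Grönwall bound for the sampling error needs to reach the
fraction `σ / (1 + σ)` of its forcing term. -/
lemma gronwallBound_tauD {cA cΦ σ δ : ℝ} (hA : 0 ≤ cA) (hσ : 0 < σ) :
    gronwallBound 0 cA δ (tauD cA cΦ σ) = δ * (σ / (1 + σ) / max cΦ 1) := by
  have hmax : 0 < max cΦ 1 := lt_max_of_lt_right one_pos
  by_cases h : cA = 0
  · simp [tauD, h, gronwallBound_K0]
  · have hA' : 0 < cA := lt_of_le_of_ne hA (Ne.symm h)
    have h1 : 0 < σ / (1 + σ) * (cA / max cΦ 1) + 1 := by positivity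
    rw [gronwallBound_of_K_ne_0 h, tauD, if_neg h]
    simp only [zero_mul, zero_add]
    rw [← mul_assoc, mul_one_div_cancel h, one_mul, Real.exp_log h1]
    field_simp
    ring

section Solution

variable {n m : ℕ} {P : Loop n m} {d : ℝ → Vec n} {φ : Arc n}

/-- During the dwell time the sampling error is small relative to the state and the disturbance.
It satisfies `ė = A e - (A + B K) x(t_k) - d`, and `|x(t_k)| ≤ |x| + |e|`. -/
lemma IsSolution.error_le (h : IsSolution P d φ) {cA cΦ σ D : ℝ} (hA : norm2 P.A ≤ cA)
    (hΦ : norm2 (P.A + P.B * P.K) ≤ cΦ) (hσ : 0 < σ) {k : ℕ} (hk : k ∈ φ.idx) {s : ℝ}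
    (hs : s ∈ φ.flow k) (hD : ∀ u ∈ Icc 0 s, ‖d u‖ ≤ D)
    (hsτ : s ≤ φ.t k + tauD cA cΦ σ) : ‖φ.e k s‖ ≤ σ * (‖φ.x s‖ + D) := by
  have hA0 : 0 ≤ cA := (norm2_nonneg _).trans hA
  have hs0 : 0 ≤ s := h.dom_nonneg hs.1
  have hD0 : 0 ≤ D := (norm_nonneg _).trans (hD 0 ⟨le_rfl, hs0⟩)
  have hΦ0 : 0 ≤ cΦ := (norm2_nonneg _).trans hΦ
  set xk := φ.x (φ.t k) with hxk
  have h1 := norm_le_gronwallBound_of_ae (f := fun u ↦ xk - φ.x u) (K := cA)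
    (ε := cΦ * ‖xk‖ + D) (δ := 0) hs.2.1
    (absolutelyContinuous_const_sub (h.ac_x k hk s hs) _)
    (f' := fun u ↦ -(P.field (φ.x u) (φ.e k u) (d u)))
    (by
      filter_upwards [h.deriv_x_Icc hk hs] with u h1 hu using (h1 hu).const_sub _)
    (by
      refine Eventually.of_forall fun u hu ↦ ?_
      have hu0 : 0 ≤ u := h.dom_nonneg (h.Icc_subset_flow hk hs hu).1
      have e1 : P.field (φ.x u) (φ.e k u) (d u) =
          -(toEuclideanLin P.A (xk - φ.x u)) + toEuclideanLin (P.A + P.B * P.K) xk + d u := by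
        unfold Loop.field Arc.e
        rw [← hxk]
        simp only [map_add, map_sub, LinearMap.add_apply]
        abel
      rw [norm_neg, e1]
      refine norm_add₃_le.trans ?_
      rw [norm_neg]
      have e2 := (norm_toEuclideanLin_le P.A (xk - φ.x u)).trans
        (mul_le_mul_of_nonneg_right hA (norm_nonneg _))
      have e3 := (norm_toEuclideanLin_le (P.A + P.B * P.K) xk).trans
        (mul_le_mul_of_nonneg_right hΦ (norm_nonneg _))
      have e4 := hD u ⟨hu0, hu.2⟩
      linarith)
    (by simp [hxk])
  have h2 : gronwallBound 0 cA (cΦ * ‖xk‖ + D) (s - φ.t k) ≤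
      gronwallBound 0 cA (cΦ * ‖xk‖ + D) (tauD cA cΦ σ) :=
    gronwallBound_mono le_rfl (by positivity) hA0 (by linarith)
  rw [gronwallBound_tauD hA0 hσ] at h2
  have hmax : 0 < max cΦ 1 := lt_max_of_lt_right one_pos
  have h3 : cΦ * ‖xk‖ + D ≤ max cΦ 1 * (‖xk‖ + D) := by
    rw [mul_add]
    have h31 := mul_le_mul_of_nonneg_right (le_max_left cΦ 1) (norm_nonneg xk)
    have h32 := mul_le_mul_of_nonneg_right (le_max_right cΦ 1) hD0
    linarith
  have h4 : (cΦ * ‖xk‖ + D) * (σ / (1 + σ) / max cΦ 1) ≤ σ / (1 + σ) * (‖xk‖ + D) := by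
    rw [mul_div_assoc', div_le_iff₀ hmax]
    have := mul_le_mul_of_nonneg_right h3 (show 0 ≤ σ / (1 + σ) by positivity)
    linarith
  have h5 : ‖φ.e k s‖ ≤ σ / (1 + σ) * (‖xk‖ + D) := h1.trans (h2.trans h4)
  have h6 : ‖xk‖ ≤ ‖φ.x s‖ + ‖φ.e k s‖ := by
    have : xk = φ.x s + φ.e k s := by unfold Arc.e; rw [← hxk]; abel
    calc ‖xk‖ = ‖φ.x s + φ.e k s‖ := by rw [← this]
      _ ≤ _ := norm_add_le _ _
  rw [div_mul_eq_mul_div, le_div_iff₀ (by positivity)] at h5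
  have h7 := mul_le_mul_of_nonneg_left h6 hσ.le
  linarith

/-! ### Decay of the Lyapunov function -/

/-- The quadratic form `xᵀ S x`. -/
noncomputable def form (S : Matrix (Fin n) (Fin n) ℝ) (x : Vec n) : ℝ :=
  inner ℝ x (toEuclideanLin S x)

lemma inner_toEuclideanLin_symm {S : Matrix (Fin n) (Fin n) ℝ} (hS : Sᵀ = S) (x y : Vec n) :
    inner ℝ x (toEuclideanLin S y) = inner ℝ y (toEuclideanLin S x) := by
  rw [inner_toEuclideanLin, inner_toEuclideanLin, dotProduct_mulVec_eq, hS, dotProduct_comm]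

lemma hasDerivAt_form {S : Matrix (Fin n) (Fin n) ℝ} (hS : Sᵀ = S) {x : ℝ → Vec n} {v : Vec n}
    {s : ℝ} (hx : HasDerivAt x v s) :
    HasDerivAt (fun u ↦ form S (x u)) (2 * inner ℝ (x s) (toEuclideanLin S v)) s := by
  have h1 : HasDerivAt (fun u ↦ toEuclideanLin S (x u)) (toEuclideanLin S v) s :=
    (LinearMap.toContinuousLinearMap (toEuclideanLin S)).hasFDerivAt.comp_hasDerivAt s hx
  have h2 := hx.inner ℝ h1
  rw [inner_toEuclideanLin_symm hS v, ← two_mul] at h2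
  exact h2

lemma absolutelyContinuous_form (S : Matrix (Fin n) (Fin n) ℝ) {x : ℝ → Vec n} {a b : ℝ}
    (hx : AbsolutelyContinuousOnInterval x a b) :
    AbsolutelyContinuousOnInterval (fun u ↦ form S (x u)) a b := by
  obtain ⟨M, hM⟩ := hx.exists_bound
  refine absolutelyContinuous_of_dist_le (C := 2 * M * norm2 S) hx fun s hs t ht ↦ ?_
  have h1 : form S (x s) - form S (x t) = inner ℝ (x s - x t) (toEuclideanLin S (x s)) +
      inner ℝ (x t) (toEuclideanLin S (x s - x t)) := by
    unfold form
    rw [map_sub, inner_sub_left, inner_sub_right]; ring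
  have hM0 : 0 ≤ M := (norm_nonneg _).trans (hM s hs)
  have h2 : |inner ℝ (x s - x t) (toEuclideanLin S (x s))| ≤ ‖x s - x t‖ * (norm2 S * M) :=
    (abs_real_inner_le_norm _ _).trans (mul_le_mul_of_nonneg_left
      ((norm_toEuclideanLin_le S _).trans (mul_le_mul_of_nonneg_left (hM s hs) (norm2_nonneg _)))
      (norm_nonneg _))
  have h3 : |inner ℝ (x t) (toEuclideanLin S (x s - x t))| ≤ M * (norm2 S * ‖x s - x t‖) :=
    (abs_real_inner_le_norm _ _).trans (mul_le_mul (hM t ht)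
      (norm_toEuclideanLin_le S _) (norm_nonneg _) hM0)
  rw [Real.dist_eq, dist_eq_norm, h1]
  refine (abs_add_le _ _).trans ?_
  linarith

/-- What the Lyapunov argument needs to know about the closed loop: the derivative of `μ xᵀ S x`
is bounded by the triggering form up to a negative term in `x`, and by that negative term alone as
long as the sampling error is small relative to the state and the disturbance. -/
structure Dissipative (P : Loop n m) (S : Matrix (Fin n) (Fin n) ℝ) (μ σ a b : ℝ) : Prop where
  of_quad : ∀ x e d : Vec n, 2 * μ * inner ℝ x (toEuclideanLin S (P.field x e d)) ≤
    quad P.Ψ x e - a * ‖x‖ ^ 2 + b * ‖x‖ * ‖d‖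
  of_error : ∀ (x e d : Vec n) (D : ℝ), ‖e‖ ≤ σ * (‖x‖ + D) → ‖d‖ ≤ D →
    2 * μ * inner ℝ x (toEuclideanLin S (P.field x e d)) ≤ -a * ‖x‖ ^ 2 + b * ‖x‖ * D

/-- Along solutions, `W = μ xᵀ S x + η` satisfies `W' ≤ -c W + κ`: during the dwell time because the
sampling error is small, and afterwards because the triggering form cancels between the derivatives
of `μ xᵀ S x` and of `η`. -/
lemma IsSolution.lyapunov_flow (h : IsSolution P d φ) (hlam : 0 < P.lam) (hθ : 0 ≤ P.θ)
    (hτ : 0 ≤ P.τ) (hν : 0 ≤ P.ν) {S : Matrix (Fin n) (Fin n) ℝ} (hS : Sᵀ = S) {μ σ a b c D : ℝ}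
    (ha : 0 < a) (hb : 0 ≤ b)
    (hdis : Dissipative P S μ σ a b) (hc : 0 < c) (hclam : c ≤ P.lam)
    (hcS : ∀ x, c * (μ * form S x) ≤ a / 2 * ‖x‖ ^ 2) {k : ℕ} (hk : k ∈ φ.idx) {s : ℝ}
    (hs : s ∈ φ.flow k) (hD : ∀ u ∈ Icc 0 s, ‖d u‖ ≤ D)
    (herr : ∀ u ∈ Icc (φ.t k) s, u < φ.t k + P.τ → ‖φ.e k u‖ ≤ σ * (‖φ.x u‖ + D)) :
    (μ * form S (φ.x s) + φ.η s) - (b ^ 2 / (2 * a) * D ^ 2 + P.ν) / c ≤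
      Real.exp (-c * (s - φ.t k)) * ((μ * form S (φ.x (φ.t k)) + φ.η (φ.t k)) -
        (b ^ 2 / (2 * a) * D ^ 2 + P.ν) / c) := by
  refine le_exp_of_ae_deriv_le (f := fun u ↦ μ * form S (φ.x u) + φ.η u) hc hs.2.1
    (((absolutelyContinuous_form S (h.ac_x k hk s hs)).const_mul μ).fun_add (h.ac_η k hk s hs))
    (f' := fun u ↦ μ * (2 * inner ℝ (φ.x u) (toEuclideanLin S
      (P.field (φ.x u) (φ.e k u) (d u)))) + (-P.lam * φ.η u -
        (if φ.t k + P.τ < u then quad P.Ψ (φ.x u) (φ.e k u) - P.ν else 0))) ?_ ?_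
  · filter_upwards [h.deriv_x_Icc hk hs, h.deriv_η_Icc hk hs] with u h1 h2 hu
    exact ((hasDerivAt_form hS (h1 hu)).const_mul μ).add (h2 hu).2
  · filter_upwards [h.deriv_η_Icc hk hs] with u h2 hu
    have hudom := (h.Icc_subset_flow hk hs hu).1
    have hu0 : 0 ≤ u := h.dom_nonneg hudom
    have hη := h.η_nonneg hlam hθ hτ hudom
    have hdu := hD u ⟨hu0, hu.2⟩
    have hcη := mul_le_mul_of_nonneg_right hclam hη
    have hcx := hcS (φ.x u)
    -- Young's inequality for the product of the state and the disturbance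
    have hyoung : b * ‖φ.x u‖ * D ≤ a / 2 * ‖φ.x u‖ ^ 2 + b ^ 2 / (2 * a) * D ^ 2 := by
      have e1 : a / 2 * ‖φ.x u‖ ^ 2 + b ^ 2 / (2 * a) * D ^ 2 - b * ‖φ.x u‖ * D =
          (a * ‖φ.x u‖ - b * D) ^ 2 / (2 * a) := by field_simp; ring
      have e2 : 0 ≤ (a * ‖φ.x u‖ - b * D) ^ 2 / (2 * a) := by positivity
      linarith
    split_ifs with h3
    · have e1 := hdis.of_quad (φ.x u) (φ.e k u) (d u)
      have e2 := mul_le_mul_of_nonneg_left hdu (mul_nonneg hb (norm_nonneg (φ.x u)))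
      linarith
    · have h4 : u < φ.t k + P.τ := lt_of_le_of_ne (not_lt.mp h3) (h2 hu).1
      have e1 := hdis.of_error (φ.x u) (φ.e k u) (d u) D (herr u hu h4) hdu
      linarith

/-- The decay of the Lyapunov function on the whole domain. -/
lemma IsSolution.lyapunov (h : IsSolution P d φ) (hlam : 0 < P.lam) (hθ : 0 ≤ P.θ)
    (hτ : 0 ≤ P.τ) (hν : 0 ≤ P.ν) {S : Matrix (Fin n) (Fin n) ℝ} (hS : Sᵀ = S) {μ σ a b c D : ℝ}
    (ha : 0 < a) (hb : 0 ≤ b)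
    (hdis : Dissipative P S μ σ a b) (hc : 0 < c) (hclam : c ≤ P.lam)
    (hcS : ∀ x, c * (μ * form S x) ≤ a / 2 * ‖x‖ ^ 2) {s : ℝ} (hs : s ∈ φ.dom)
    (hD : ∀ u ∈ Icc 0 s, ‖d u‖ ≤ D)
    (herr : ∀ k ∈ φ.idx, ∀ u ∈ φ.flow k, u ≤ s → u < φ.t k + P.τ →
      ‖φ.e k u‖ ≤ σ * (‖φ.x u‖ + D)) :
    (μ * form S (φ.x s) + φ.η s) - (b ^ 2 / (2 * a) * D ^ 2 + P.ν) / c ≤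
      Real.exp (-c * s) * ((μ * form S (φ.x 0) + φ.η 0) -
        (b ^ 2 / (2 * a) * D ^ 2 + P.ν) / c) := by
  set κ := (b ^ 2 / (2 * a) * D ^ 2 + P.ν) / c with hκ
  have step : ∀ k ∈ φ.idx, ∀ u ∈ φ.flow k, u ≤ s →
      (μ * form S (φ.x (φ.t k)) + φ.η (φ.t k)) - κ ≤
        Real.exp (-c * φ.t k) * ((μ * form S (φ.x 0) + φ.η 0) - κ) →
      (μ * form S (φ.x u) + φ.η u) - κ ≤
        Real.exp (-c * u) * ((μ * form S (φ.x 0) + φ.η 0) - κ) := by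
    intro k hk u hu hus hk0
    have h1 := h.lyapunov_flow hlam hθ hτ hν hS ha hb hdis hc hclam hcS hk hu
      (fun v hv ↦ hD v ⟨hv.1, hv.2.trans hus⟩)
      (fun v hv hv' ↦ herr k hk v (h.Icc_subset_flow hk hu hv) (hv.2.trans hus) hv')
    rw [← hκ] at h1
    refine h1.trans ?_
    have h2 := mul_le_mul_of_nonneg_left hk0 (Real.exp_pos (-c * (u - φ.t k))).le
    rw [← mul_assoc, ← Real.exp_add] at h2
    have h3 : -c * (u - φ.t k) + -c * φ.t k = -c * u := by ring
    rwa [h3] at h2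
  have base : ∀ k ∈ φ.idx, φ.t k ≤ s → (μ * form S (φ.x (φ.t k)) + φ.η (φ.t k)) - κ ≤
      Real.exp (-c * φ.t k) * ((μ * form S (φ.x 0) + φ.η 0) - κ) := by
    intro k
    induction k with
    | zero => intro _ _; rw [h.t_zero]; simp
    | succ k ih =>
      intro hk hks
      have hk' := h.idx_pred k hk
      exact step k hk' _ (h.t_succ_mem_flow hτ hk) hks
        (ih hk' (by linarith [h.add_le_t_succ hk]))
  obtain ⟨k, hk, hsk⟩ := h.cover s hs
  exact step k hk s hsk le_rfl (base k hk hsk.2.1)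

end Solution

/-! ### Completeness of maximal solutions -/

lemma absolutelyContinuous_self {X : Type*} [PseudoMetricSpace X] (f : ℝ → X) (a : ℝ) :
    AbsolutelyContinuousOnInterval f a a := by
  refine LipschitzOnWith.absolutelyContinuousOnInterval (K := 0) ?_
  rw [uIcc_self]
  rintro s rfl t rfl
  simp

section Solution

variable {n m : ℕ} {P : Loop n m} {d : ℝ → Vec n} {φ : Arc n}

lemma Loop.field_sub (P : Loop n m) (xN x d : Vec n) :
    P.field x (xN - x) d = toEuclideanCLM (n := Fin n) (𝕜 := ℝ) P.A x +
      (toEuclideanLin (P.B * P.K) xN + d) := by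
  have h : toEuclideanCLM (n := Fin n) (𝕜 := ℝ) P.A x = toEuclideanLin P.A x := rfl
  rw [h]
  unfold Loop.field
  simp only [map_add, map_sub, LinearMap.add_apply]
  abel

/-- The closed loop without any further transmission, started at time `a`: `X` and `H` are the
trajectories of the plant and of the auxiliary variable on `[a, ∞)`. -/
structure IsContinuation (P : Loop n m) (d : ℝ → Vec n) (a : ℝ) (X : ℝ → Vec n) (H : ℝ → ℝ) :
    Prop where
  ac_x : ∀ b, a ≤ b → AbsolutelyContinuousOnInterval X a b
  ac_η : ∀ b, a ≤ b → AbsolutelyContinuousOnInterval H a b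
  deriv_x : ∀ᵐ s, a < s → HasDerivAt X (P.field (X s) (X a - X s) (d s)) s
  deriv_η : ∀ᵐ s, a < s → HasDerivAt H (-P.lam * H s -
    (if a + P.τ < s then quad P.Ψ (X s) (X a - X s) - P.ν else 0)) s

lemma continuousOn_Ici_of_absolutelyContinuous {E : Type*} [NormedAddCommGroup E] {f : ℝ → E}
    {a : ℝ} (h : ∀ b, a ≤ b → AbsolutelyContinuousOnInterval f a b) : ContinuousOn f (Ici a) := by
  intro s hs
  have hs' : a ≤ s := hs
  have h1 := (h (s + 1) (by linarith)).continuousOn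
  rw [uIcc_of_le (by linarith)] at h1
  refine (h1 s ⟨hs', by linarith⟩).mono_of_mem_nhdsWithin ?_
  have h2 : Iic (s + 1) ∈ 𝓝 s := Iic_mem_nhds (by linarith)
  filter_upwards [self_mem_nhdsWithin, nhdsWithin_le_nhds h2] with u hu hu' using ⟨hu, hu'⟩

lemma exists_continuation (P : Loop n m) (hd : IsDisturbance d) {a : ℝ} (ha : 0 ≤ a)
    (x₀ : Vec n) (η₀ : ℝ) :
    ∃ X H, IsContinuation P d a X H ∧ X a = x₀ ∧ H a = η₀ := by
  obtain ⟨hdm, M, hM⟩ := hd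
  have hdb : ∀ s, 0 ≤ s → ‖d s‖ ≤ M := fun s hs ↦ hM ⟨s, hs, rfl⟩
  obtain ⟨X, hXa, hXac, hXd⟩ := exists_linear_ode_solution
    (toEuclideanCLM (n := Fin n) (𝕜 := ℝ) P.A) (fun s ↦ toEuclideanLin (P.B * P.K) x₀ + d s) a x₀
    (by
      have h1 : AEMeasurable d (volume.restrict (Ici a)) :=
        hdm.mono_measure (Measure.restrict_mono (Ici_subset_Ici.mpr ha) le_rfl)
      exact (aemeasurable_const.add h1).aestronglyMeasurable)
    (fun b ↦ ⟨‖toEuclideanLin (P.B * P.K) x₀‖ + M, fun s hs ↦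
      (norm_add_le _ _).trans (add_le_add le_rfl (hdb s (ha.trans hs.1)))⟩)
  set f : ℝ → ℝ := fun s ↦ -(quad P.Ψ (X s) (X a - X s) - P.ν) with hf
  have hXc := continuousOn_Ici_of_absolutelyContinuous hXac
  have hfc : ContinuousOn f (Ici a) :=
    (((continuous_quad P.Ψ).comp_continuousOn
      (hXc.prodMk (continuousOn_const.sub hXc))).sub continuousOn_const).neg
  obtain ⟨H, hHa, hHac, hHd⟩ := exists_linear_ode_solution
    (-P.lam • ContinuousLinearMap.id ℝ ℝ) ((Ioi (a + P.τ)).indicator f) a η₀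
    ((hfc.aestronglyMeasurable measurableSet_Ici).indicator measurableSet_Ioi)
    (fun b ↦ by
      obtain ⟨C, hC⟩ := (isCompact_Icc (a := a) (b := b)).exists_bound_of_continuousOn
        (hfc.mono Icc_subset_Ici_self)
      exact ⟨C, fun s hs ↦ (norm_indicator_le_norm_self _ _).trans (hC s hs)⟩)
  refine ⟨X, H, ⟨hXac, hHac, ?_, ?_⟩, hXa, hHa⟩
  · filter_upwards [hXd] with s hs has
    rw [P.field_sub, hXa]
    exact hs has
  · filter_upwards [hHd] with s hs has
    refine (hs has).congr_deriv ?_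
    by_cases h1 : a + P.τ < s
    · rw [if_pos h1, indicator_of_mem (by exact h1)]
      simp [hf]
      ring
    · rw [if_neg h1, indicator_of_notMem (by exact h1)]
      simp

/-- On its last interval of flow, a solution agrees with the continuation. -/
lemma IsSolution.eq_continuation (h : IsSolution P d φ) {N : ℕ} (hN : N ∈ φ.idx)
    {X : ℝ → Vec n} {H : ℝ → ℝ} (hc : IsContinuation P d (φ.t N) X H) (hX : X (φ.t N) = φ.x (φ.t N))
    (hH : H (φ.t N) = φ.η (φ.t N)) {s : ℝ} (hs : s ∈ φ.flow N) : φ.x s = X s ∧ φ.η s = H s := by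
  have hx : ∀ u ∈ φ.flow N, φ.x u = X u := by
    intro u hu
    refine linear_ode_unique (toEuclideanCLM (n := Fin n) (𝕜 := ℝ) P.A)
      (fun s ↦ toEuclideanLin (P.B * P.K) (φ.x (φ.t N)) + d s) hu.2.1 (h.ac_x N hN u hu)
      (hc.ac_x u hu.2.1) ?_ ?_ hX.symm
    · filter_upwards [h.deriv_x_Icc hN hu] with v hv hvI
      have := hv hvI
      unfold Arc.e at this
      rwa [P.field_sub] at this
    · filter_upwards [hc.deriv_x, ae_ne (φ.t N)] with v hv hv' hvI
      have := hv (lt_of_le_of_ne hvI.1 hv'.symm)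
      rwa [P.field_sub, hX] at this
  refine ⟨hx s hs, ?_⟩
  refine linear_ode_unique (-P.lam • ContinuousLinearMap.id ℝ ℝ)
    (fun u ↦ -(if φ.t N + P.τ < u then quad P.Ψ (X u) (X (φ.t N) - X u) - P.ν else 0)) hs.2.1
    (h.ac_η N hN s hs) (hc.ac_η s hs.2.1) ?_ ?_ hH.symm
  · filter_upwards [h.deriv_η_Icc hN hs] with v hv hvI
    have h1 := (hv hvI).2
    have h2 : φ.e N v = X (φ.t N) - X v := by
      unfold Arc.e; rw [hx v (h.Icc_subset_flow hN hs hvI), hX]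
    rw [h2, hx v (h.Icc_subset_flow hN hs hvI)] at h1
    exact h1.congr_deriv (sub_eq_add_neg _ _)
  · filter_upwards [hc.deriv_η, ae_ne (φ.t N)] with v hv hv' hvI
    exact (hv (lt_of_le_of_ne hvI.1 hv'.symm)).congr_deriv (sub_eq_add_neg _ _)

lemma IsSolution.mem_idx_of_le (h : IsSolution P d φ) {j k : ℕ} (hk : k ∈ φ.idx) (hjk : j ≤ k) :
    j ∈ φ.idx := by
  induction k with
  | zero => rwa [Nat.le_zero.mp hjk]
  | succ k ih =>
    rcases Nat.le_succ_iff.mp hjk with h1 | h1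
    · exact ih (h.idx_pred k hk) h1
    · rwa [h1]

lemma IsSolution.t_mono (h : IsSolution P d φ) (hτ : 0 ≤ P.τ) {j k : ℕ} (hk : k ∈ φ.idx)
    (hjk : j ≤ k) : φ.t j ≤ φ.t k := by
  induction k with
  | zero => rw [Nat.le_zero.mp hjk]
  | succ k ih =>
    rcases Nat.le_succ_iff.mp hjk with h1 | h1
    · exact (ih (h.idx_pred k hk) h1).trans (by linarith [h.add_le_t_succ hk])
    · rw [h1]

lemma IsContinuation.isClosed_trig {a : ℝ} {X : ℝ → Vec n} {H : ℝ → ℝ}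
    (hc : IsContinuation P d a X H) (hτ : 0 ≤ P.τ) :
    IsClosed {s | a + P.τ ≤ s ∧ P.Trig (X s) (X a - X s) (H s)} := by
  have hX := continuousOn_Ici_of_absolutelyContinuous hc.ac_x
  have hH := continuousOn_Ici_of_absolutelyContinuous hc.ac_η
  have hq : ContinuousOn (fun s ↦ quad P.Ψ (X s) (X a - X s) - P.ν) (Ici a) :=
    ((continuous_quad P.Ψ).comp_continuousOn
      (hX.prodMk (continuousOn_const.sub hX))).sub continuousOn_const
  have h1 := (hH.sub (continuousOn_const.mul hq) : ContinuousOn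
    (fun s ↦ H s - P.θ * (quad P.Ψ (X s) (X a - X s) - P.ν)) (Ici a))
  have h2 := ((continuousOn_const.mul hH).sub hq : ContinuousOn
    (fun s ↦ -P.lam * H s - (quad P.Ψ (X s) (X a - X s) - P.ν)) (Ici a))
  have c1 := h1.preimage_isClosed_of_isClosed isClosed_Ici (isClosed_Iic (a := (0 : ℝ)))
  have c2 := h2.preimage_isClosed_of_isClosed isClosed_Ici (isClosed_Iic (a := (0 : ℝ)))
  by_cases hθτ : P.θ = 0 ∧ P.τ = 0
  · convert (isClosed_Ici (a := a + P.τ)).inter (c1.inter c2) using 1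
    ext s
    constructor
    · rintro ⟨hs, ht⟩
      have hs' : s ∈ Ici a := by simp only [mem_Ici]; linarith
      exact ⟨hs, ⟨hs', ht.1⟩, hs', ht.2 hθτ.1 hθτ.2⟩
    · rintro ⟨hs, ht, ht'⟩
      exact ⟨hs, ht.2, fun _ _ ↦ ht'.2⟩
  · convert (isClosed_Ici (a := a + P.τ)).inter c1 using 1
    ext s
    constructor
    · rintro ⟨hs, ht⟩
      have hs' : s ∈ Ici a := by simp only [mem_Ici]; linarith
      exact ⟨hs, hs', ht.1⟩
    · rintro ⟨hs, ht⟩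
      exact ⟨hs, ht.2, fun e1 e2 ↦ (hθτ ⟨e1, e2⟩).elim⟩

/-- A solution with a last transmission whose domain is bounded can be extended: up to the first
time at which the continuation triggers a transmission, that transmission included, or to
`[0, ∞)` if it never does. -/
lemma IsSolution.exists_extension (h : IsSolution P d φ) (hd : IsDisturbance d)
    (hlam : 0 < P.lam) (hθ : 0 ≤ P.θ) (hτ : 0 ≤ P.τ) (hν : P.τ = 0 → 0 < P.ν)
    (hq : ∀ x : Vec n, quad P.Ψ x 0 ≤ 0) {N : ℕ} (hN : N ∈ φ.idx) (hN1 : N + 1 ∉ φ.idx) {r : ℝ}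
    (hr0 : 0 ≤ r) (hr : r ∉ φ.dom) :
    ∃ φ' : Arc n, IsSolution P d φ' ∧ φ'.Extends φ ∧ φ'.dom ≠ φ.dom := by
  set a := φ.t N with ha
  have ha0 : 0 ≤ a := h.dom_nonneg (h.t_mem N hN)
  obtain ⟨X, H, hc, hX, hH⟩ := exists_continuation P hd ha0 (φ.x a) (φ.η a)
  set Z := {s | a + P.τ ≤ s ∧ P.Trig (X s) (X a - X s) (H s)} with hZ
  have hZclosed : IsClosed Z := hc.isClosed_trig hτ
  have hZa : ∀ z ∈ Z, a ≤ z := fun z hz ↦ by linarith [hz.1]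
  have hZleast : Z.Nonempty → IsLeast Z (sInf Z) := fun hne ↦
    hZclosed.isLeast_csInf hne ⟨a, hZa⟩
  have hmemN : ∀ s ∈ φ.dom, a ≤ s → s ∈ φ.flow N := fun s hs has ↦
    ⟨hs, has, fun h1 ↦ (hN1 h1).elim⟩
  have hagree : ∀ s ∈ φ.dom, a ≤ s → φ.x s = X s ∧ φ.η s = H s := fun s hs has ↦
    h.eq_continuation hN hc hX hH (hmemN s hs has)
  have hZdom : ∀ z ∈ Z, z ∉ φ.dom := by
    intro z hz hzd
    have h1 := hagree z hzd (hZa z hz)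
    have h2 : z ∈ φ.trigSet P N := by
      refine ⟨hzd, hz.1, ?_⟩
      unfold Arc.e
      rw [h1.1, h1.2, ← ha, ← hX]
      exact hz.2
    rw [h.last N hN hN1] at h2
    exact h2
  have hidx : ∀ k ∈ φ.idx, k ≤ N := fun k hk ↦ by
    by_contra! hcon
    exact hN1 (h.mem_idx_of_le hk hcon)
  have hdomlt : ∀ s ∈ φ.dom, ∀ z ∈ Z, s < z := by
    intro s hs z hz
    by_contra! hcon
    exact hZdom z hz (h.ordConnected.out h.zero_mem hs ⟨ha0.trans (hZa z hz), hcon⟩)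
  set φ' : Arc n :=
    { dom := {s | 0 ≤ s ∧ ∀ z ∈ Z, s ≤ z}
      idx := φ.idx ∪ {k | k = N + 1 ∧ Z.Nonempty}
      t := Function.update φ.t (N + 1) (sInf Z)
      x := fun s ↦ if s < a then φ.x s else X s
      η := fun s ↦ if s < a then φ.η s else H s } with hφ'
  have ht : ∀ k ≤ N, φ'.t k = φ.t k := fun k hk ↦
    Function.update_of_ne (by omega) _ _
  have htN : φ'.t (N + 1) = sInf Z := Function.update_self _ _ _
  have hx : ∀ s ∈ φ.dom, φ'.x s = φ.x s := by
    intro s hs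
    by_cases hsa : s < a
    · exact if_pos hsa
    · exact (if_neg hsa).trans (hagree s hs (not_lt.mp hsa)).1.symm
  have hη : ∀ s ∈ φ.dom, φ'.η s = φ.η s := by
    intro s hs
    by_cases hsa : s < a
    · exact if_pos hsa
    · exact (if_neg hsa).trans (hagree s hs (not_lt.mp hsa)).2.symm
  have hxX : ∀ s, a ≤ s → φ'.x s = X s := fun s hs ↦ if_neg (not_lt.mpr hs)
  have hηH : ∀ s, a ≤ s → φ'.η s = H s := fun s hs ↦ if_neg (not_lt.mpr hs)
  have hdom : φ.dom ⊆ φ'.dom := fun s hs ↦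
    ⟨h.dom_nonneg hs, fun z hz ↦ (hdomlt s hs z hz).le⟩
  have hsucc : ∀ k < N, k + 1 ∈ φ.idx := fun k hk ↦ h.mem_idx_of_le hN hk
  have hcases : ∀ k ∈ φ'.idx, (k < N ∧ k ∈ φ.idx) ∨ k = N ∨ (k = N + 1 ∧ Z.Nonempty) := by
    rintro k (hk | hk)
    · rcases (hidx k hk).lt_or_eq with h1 | h1
      · exact Or.inl ⟨h1, hk⟩
      · exact Or.inr (Or.inl h1)
    · exact Or.inr (Or.inr hk)
  -- before the last transmission of the given solution nothing changes
  have hflow : ∀ k < N, ∀ s ∈ φ'.flow k, s ∈ φ.flow k ∧ s ≤ a := by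
    rintro k hk s ⟨hs1, hs2, hs3⟩
    have h1 := hs3 (Or.inl (hsucc k hk))
    rw [ht (k + 1) hk] at h1
    rw [ht k hk.le] at hs2
    refine ⟨⟨h.ordConnected.out h.zero_mem (h.t_mem _ (hsucc k hk)) ⟨hs1.1, h1⟩, hs2,
      fun _ ↦ h1⟩, h1.trans (h.t_mono hτ hN hk)⟩
  have hflowN : ∀ s ∈ φ'.flow N, a ≤ s := by
    rintro s ⟨_, hs2, _⟩
    rwa [ht N le_rfl] at hs2
  have hflowN1 : Z.Nonempty → ∀ s ∈ φ'.flow (N + 1), s = sInf Z := by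
    rintro hne s ⟨hs1, hs2, _⟩
    rw [htN] at hs2
    exact le_antisymm (hs1.2 _ (hZleast hne).1) hs2
  have he : ∀ k ≤ N, k ∈ φ.idx → ∀ s ∈ φ.dom, φ'.e k s = φ.e k s := by
    intro k hkN hk s hs
    unfold Arc.e
    rw [ht k hkN, hx s hs, hx _ (h.t_mem k hk)]
  have heN : ∀ s, a ≤ s → φ'.e N s = X a - X s := by
    intro s hs
    unfold Arc.e
    rw [ht N le_rfl, hxX s hs, hxX _ le_rfl]
  have hZdom' : Z.Nonempty → sInf Z ∈ φ'.dom := fun hne ↦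
    ⟨ha0.trans (hZa _ (hZleast hne).1), fun z hz ↦ (hZleast hne).2 hz⟩
  have htrigN : φ'.trigSet P N = {s | s ∈ φ'.dom ∧ s ∈ Z} := by
    ext s
    constructor
    · rintro ⟨h1, h2, h3⟩
      rw [ht N le_rfl] at h2
      have h4 : a ≤ s := by linarith
      rw [heN s h4, hxX s h4, hηH s h4] at h3
      exact ⟨h1, h2, h3⟩
    · rintro ⟨h1, h2⟩
      have h4 := hZa s h2
      refine ⟨h1, ?_, ?_⟩
      · rw [ht N le_rfl]; exact h2.1
      · rw [heN s h4, hxX s h4, hηH s h4]; exact h2.2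
  have hext : φ'.Extends φ :=
    ⟨hdom, subset_union_left, fun k hk ↦ ht k (hidx k hk), fun s hs ↦ ⟨hx s hs, hη s hs⟩⟩
  refine ⟨φ', ?_, hext, ?_⟩
  swap
  · intro heq
    by_cases hne : Z.Nonempty
    · exact hZdom _ (hZleast hne).1 (heq ▸ hZdom' hne)
    · refine hr (heq ▸ ⟨hr0, fun z hz ↦ (hne ⟨z, hz⟩).elim⟩)
  refine
    { zero_mem := hdom h.zero_mem
      dom_nonneg := fun s hs ↦ hs.1
      ordConnected := ⟨fun s hs u hu v hv ↦ ⟨hs.1.trans hv.1, fun z hz ↦ hv.2.trans (hu.2 z hz)⟩⟩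
      zero_idx := Or.inl h.zero_idx
      idx_pred := ?_
      t_zero := (ht 0 (Nat.zero_le _)).trans h.t_zero
      t_mem := ?_
      cover := ?_
      η_init := by rw [hη 0 h.zero_mem]; exact h.η_init
      ac_x := ?_
      ac_η := ?_
      deriv_x := ?_
      deriv_η := ?_
      next := ?_
      last := ?_ }
  · rintro k (hk | ⟨hk, -⟩)
    · exact Or.inl (h.idx_pred k hk)
    · rw [Nat.add_right_cancel hk]; exact Or.inl hN
  · rintro k (hk | ⟨rfl, hne⟩)
    · rw [ht k (hidx k hk)]; exact hdom (h.t_mem k hk)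
    · rw [htN]; exact hZdom' hne
  · intro s hs
    by_cases hsd : s ∈ φ.dom
    · obtain ⟨k, hk, hsk⟩ := h.cover s hsd
      refine ⟨k, Or.inl hk, hs, ?_, ?_⟩
      · rw [ht k (hidx k hk)]; exact hsk.2.1
      · rintro (hk1 | ⟨hk1, hne⟩)
        · rw [ht _ (hidx _ hk1)]; exact hsk.2.2 hk1
        · rw [hk1, htN]; exact hs.2 _ (hZleast hne).1
    · have has : a ≤ s := by
        by_contra! hcon
        exact hsd (h.ordConnected.out h.zero_mem (h.t_mem N hN) ⟨hs.1, hcon.le⟩)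
      refine ⟨N, Or.inl hN, hs, ?_, ?_⟩
      · rw [ht N le_rfl]; exact has
      · rintro (hk1 | ⟨-, hne⟩)
        · exact (hN1 hk1).elim
        · rw [htN]; exact hs.2 _ (hZleast hne).1
  · intro k hk s hs
    rcases hcases k hk with ⟨hkN, hkm⟩ | rfl | ⟨rfl, hne⟩
    · have hsf := (hflow k hkN s hs).1
      rw [ht k hkN.le]
      refine absolutelyContinuous_congr (h.ac_x k hkm s hsf) fun u hu ↦ hx u ?_
      rw [uIcc_of_le hsf.2.1] at hu
      exact (h.Icc_subset_flow hkm hsf hu).1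
    · have has := hflowN s hs
      rw [ht k le_rfl]
      refine absolutelyContinuous_congr (hc.ac_x s has) fun u hu ↦ hxX u ?_
      rw [uIcc_of_le has] at hu
      exact hu.1
    · rw [hflowN1 hne s hs, htN]
      exact absolutelyContinuous_self _ _
  · intro k hk s hs
    rcases hcases k hk with ⟨hkN, hkm⟩ | rfl | ⟨rfl, hne⟩
    · have hsf := (hflow k hkN s hs).1
      rw [ht k hkN.le]
      refine absolutelyContinuous_congr (h.ac_η k hkm s hsf) fun u hu ↦ hη u ?_
      rw [uIcc_of_le hsf.2.1] at hu
      exact (h.Icc_subset_flow hkm hsf hu).1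
    · have has := hflowN s hs
      rw [ht k le_rfl]
      refine absolutelyContinuous_congr (hc.ac_η s has) fun u hu ↦ hηH u ?_
      rw [uIcc_of_le has] at hu
      exact hu.1
    · rw [hflowN1 hne s hs, htN]
      exact absolutelyContinuous_self _ _
  · intro k hk
    rcases hcases k hk with ⟨hkN, hkm⟩ | rfl | ⟨rfl, hne⟩
    · filter_upwards [h.deriv_x k hkm, ae_ne a] with s h1 h2 hs
      obtain ⟨hsf, hsa⟩ := hflow k hkN s hs
      have hlt : s < a := lt_of_le_of_ne hsa h2
      rw [hx s hsf.1, he k hkN.le hkm s hsf.1]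
      refine (h1 hsf).congr_of_eventuallyEq ?_
      filter_upwards [Iio_mem_nhds hlt] with u hu using if_pos hu
    · filter_upwards [hc.deriv_x, ae_ne a] with s h1 h2 hs
      have has := hflowN s hs
      have hlt : a < s := lt_of_le_of_ne has h2.symm
      rw [hxX s has, heN s has]
      refine (h1 hlt).congr_of_eventuallyEq ?_
      filter_upwards [Ioi_mem_nhds hlt] with u hu using hxX u (le_of_lt hu)
    · filter_upwards [ae_ne (sInf Z)] with s h1 hs
      exact (h1 (hflowN1 hne s hs)).elim
  · intro k hk
    rcases hcases k hk with ⟨hkN, hkm⟩ | rfl | ⟨rfl, hne⟩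
    · filter_upwards [h.deriv_η k hkm, ae_ne a] with s h1 h2 hs
      obtain ⟨hsf, hsa⟩ := hflow k hkN s hs
      have hlt : s < a := lt_of_le_of_ne hsa h2
      rw [hx s hsf.1, he k hkN.le hkm s hsf.1, ht k hkN.le, hη s hsf.1]
      obtain ⟨c, hcψ, hcd⟩ := h1 hsf
      refine ⟨c, hcψ, hcd.congr_of_eventuallyEq ?_⟩
      filter_upwards [Iio_mem_nhds hlt] with u hu using if_pos hu
    · filter_upwards [hc.deriv_η, ae_ne a, ae_ne (a + P.τ)] with s h1 h2 h3 hs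
      have has := hflowN s hs
      have hlt : a < s := lt_of_le_of_ne has h2.symm
      rw [hxX s has, heN s has, ht k le_rfl, hηH s has]
      have h4 := (h1 hlt).congr_of_eventuallyEq (f₁ := φ'.η) (by
        filter_upwards [Ioi_mem_nhds hlt] with u hu using hηH u (le_of_lt hu))
      by_cases h5 : a + P.τ < s
      · refine ⟨1, one_mem_psi (by linarith), ?_⟩
        rw [if_pos h5] at h4
        rwa [one_mul]
      · have h6 : s < a + P.τ := lt_of_le_of_ne (not_lt.mp h5) h3
        refine ⟨0, zero_mem_psi (by intro h0; linarith) (by linarith), ?_⟩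
        rw [if_neg h5] at h4
        rwa [zero_mul]
    · filter_upwards [ae_ne (sInf Z)] with s h1 hs
      exact (h1 (hflowN1 hne s hs)).elim
  · intro k hk hk1
    rcases hcases k hk with ⟨hkN, hkm⟩ | rfl | ⟨rfl, hne⟩
    · have hk1' := hsucc k hkN
      have hl := h.next k hkm hk1'
      rw [ht _ hkN]
      constructor
      · obtain ⟨g1, g2, g3⟩ := hl.1
        refine ⟨hdom g1, ?_, ?_⟩
        · rw [ht k hkN.le]; exact g2
        · rw [he k hkN.le hkm _ g1, hx _ g1, hη _ g1]; exact g3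
      · rintro s ⟨g1, g2, g3⟩
        by_cases hsd : s ∈ φ.dom
        · rw [ht k hkN.le] at g2
          rw [he k hkN.le hkm _ hsd, hx _ hsd, hη _ hsd] at g3
          exact hl.2 ⟨hsd, g2, g3⟩
        · by_contra! hcon
          exact hsd (h.ordConnected.out h.zero_mem (h.t_mem _ hk1') ⟨g1.1, hcon.le⟩)
    · have hne : Z.Nonempty := by
        rcases hk1 with g | g
        · exact (hN1 g).elim
        · exact g.2
      rw [htrigN, htN]
      exact ⟨⟨hZdom' hne, (hZleast hne).1⟩, fun s hs ↦ (hZleast hne).2 hs.2⟩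
    · exfalso
      rcases hk1 with g | g
      · have := hidx _ g; omega
      · exact absurd g.1 (by omega)
  · intro k hk hk1
    rcases hcases k hk with ⟨hkN, hkm⟩ | rfl | ⟨rfl, hne⟩
    · exact (hk1 (Or.inl (hsucc k hkN))).elim
    · rw [htrigN]
      refine eq_empty_of_forall_notMem fun s hs ↦ hk1 (Or.inr ⟨rfl, ⟨s, hs.2⟩⟩)
    · refine eq_empty_of_forall_notMem ?_
      rintro s ⟨g1, g2, g3⟩
      -- the domain ends with a transmission, at which the error is reset and `η ≥ 0`, so that the
      -- rule cannot allow another one at the same time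
      rw [htN] at g2
      have g4 := g1.2 _ (hZleast hne).1
      have hτ0 : P.τ = 0 := le_antisymm (by linarith) hτ
      have hs : s = sInf Z := le_antisymm g4 (by linarith)
      have haz : a ≤ sInf Z := hZa _ (hZleast hne).1
      have he0 : φ'.e (N + 1) s = 0 := by
        unfold Arc.e; rw [htN, hs, sub_self]
      have hHnn : 0 ≤ H (sInf Z) := by
        refine aux_nonneg P hlam hθ haz (hc.ac_η _ haz) (x := X) (e := fun u ↦ X a - X u) ?_ ?_ ?_
        · filter_upwards [hc.deriv_η, ae_ne a] with u h1 h2 hu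
          exact h1 (lt_of_le_of_ne hu.1 h2.symm)
        · intro u _ hu1 hu2 hu3
          exact hu2.not_ge ((hZleast hne).2 ⟨hu1, hu3⟩)
        · rw [hH]; exact h.η_t_nonneg hlam hθ hτ N hN
      rw [he0, hs, hηH _ haz] at g3
      have := g3.le_quad hHnn hθ (Or.inr hτ0)
      linarith [hν hτ0, hq (φ'.x (sInf Z))]

/-- Maximal solutions whose inter-event times are bounded away from zero are complete. -/
lemma IsMaximalSolution.dom_eq_Ici (h : IsMaximalSolution P d φ) (hd : IsDisturbance d)
    (hlam : 0 < P.lam) (hθ : 0 ≤ P.θ) (hτ : 0 ≤ P.τ) (hν : P.τ = 0 → 0 < P.ν)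
    (hq : ∀ x : Vec n, quad P.Ψ x 0 ≤ 0) {g : ℝ} (hg : 0 < g)
    (hgap : ∀ k, k + 1 ∈ φ.idx → g ≤ φ.t (k + 1) - φ.t k) : φ.dom = Ici 0 := by
  by_contra hne
  obtain ⟨hsol, hmax⟩ := h
  obtain ⟨r, hr0, hr⟩ : ∃ r, 0 ≤ r ∧ r ∉ φ.dom := by
    by_contra! hcon
    exact hne (Subset.antisymm hsol.dom_nonneg hcon)
  have hlt : ∀ s ∈ φ.dom, s < r := by
    intro s hs
    by_contra! hcon
    exact hr (hsol.ordConnected.out hsol.zero_mem hs ⟨hr0, hcon⟩)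
  obtain ⟨N, hN, hN1⟩ : ∃ N, N ∈ φ.idx ∧ N + 1 ∉ φ.idx := by
    by_contra! hcon
    have hall : ∀ k : ℕ, k ∈ φ.idx ∧ k * g ≤ φ.t k := by
      intro k
      induction k with
      | zero => exact ⟨hsol.zero_idx, by simp [hsol.t_zero]⟩
      | succ k ih =>
        have h1 := hcon k ih.1
        refine ⟨h1, ?_⟩
        push_cast
        linarith [hgap k h1, ih.2]
    obtain ⟨k, hk⟩ := exists_nat_ge (r / g)
    rw [div_le_iff₀ hg] at hk
    linarith [(hall k).2, hlt _ (hsol.t_mem k (hall k).1)]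
  obtain ⟨φ', h1, h2, h3⟩ := hsol.exists_extension hd hlam hθ hτ hν hq hN hN1 hr0 hr
  exact h3 (hmax φ' h1 h2).1

end Solution

/-! ### Data-based constants and the final estimate -/

/-- The matrix inequalities make the closed loop dissipative. -/
lemma dissipative_of_data {n m T s : ℕ} {P : Loop n m}
    {U0 : Matrix (Fin m) (Fin T) ℝ} {X0 X1 D0 : Matrix (Fin n) (Fin T) ℝ}
    (hdata : X1 = P.A * X0 + P.B * U0 + D0)
    {Δ : Matrix (Fin n) (Fin s) ℝ} (hD0 : (Δ * Δᵀ - D0 * D0ᵀ).PosSemidef)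
    {Ω : Matrix (Fin n) (Fin n) ℝ} (hΩ : Ω.PosDef) {ε₀ : ℝ} (hε₀ : 0 < ε₀)
    {Y : Matrix (Fin T) (Fin n) ℝ} (hY : ControllerLMI X0 X1 Δ Ω ε₀ Y)
    {S : Matrix (Fin n) (Fin n) ℝ} (hS : S = (X0 * Y)⁻¹) (hSsymm : Sᵀ = S)
    (hK : P.K = U0 * Y * (X0 * Y)⁻¹)
    {L : Matrix (Fin T) (Fin n) ℝ} (hL : fromRows U0 X0 * L = fromRows P.K 0)
    {μ ε σ₁ σ₂ : ℝ} (hμ : 0 < μ) (hε : 0 < ε) (hσ₁ : 0 < σ₁)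
    (hTrig : TriggerLMI X1 Δ Ω S L μ ε σ₂ P.Ψ) :
    Dissipative P S μ σ₁
      (min (μ / 2 * minEig (S * Ω * S)) (μ * (minEig (S * Ω * S) - σ₁ * omega2 X1 Δ S L)))
      (μ * (omega2 X1 Δ S L * σ₁ + 2 * norm2 S)) := by
  set ω := omega2 X1 Δ S L with hω
  have hω0 : 0 ≤ ω := by
    have h1 := norm2_nonneg (S * X1 * L)
    have h2 := mul_nonneg (mul_nonneg (norm2_nonneg S) (norm2_nonneg Δ)) (norm2_nonneg L)
    rw [hω]; unfold omega2; linarith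
  have hH : (S * Ω * S).IsHermitian := by
    have hΩ' : Ωᵀ = Ω := by
      have := hΩ.1
      rwa [IsHermitian, conjTranspose_eq_transpose_of_trivial] at this
    rw [IsHermitian, conjTranspose_eq_transpose_of_trivial, transpose_mul, transpose_mul, hSsymm,
      hΩ', Matrix.mul_assoc]
  have hBK : P.B * P.K = X1 * L - D0 * L := by
    have := plant_eq_of_data hdata hL
    rwa [Matrix.mul_zero, zero_add] at this
  have hfield : ∀ x e d : Vec n, inner ℝ x (toEuclideanLin S (P.field x e d)) =
      x.ofLp ⬝ᵥ (S *ᵥ ((P.A + P.B * P.K) *ᵥ x.ofLp)) +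
      x.ofLp ⬝ᵥ (S *ᵥ ((X1 * L - D0 * L) *ᵥ e.ofLp)) + inner ℝ x (toEuclideanLin S d) := by
    intro x e d
    unfold Loop.field
    rw [map_add, map_add, inner_add_right, inner_add_right, inner_toEuclideanLin,
      inner_toEuclideanLin, hBK]
    rfl
  have h1 : ∀ x : Vec n, 2 * (x.ofLp ⬝ᵥ (S *ᵥ ((P.A + P.B * P.K) *ᵥ x.ofLp))) ≤
      -(x.ofLp ⬝ᵥ ((S * Ω * S) *ᵥ x.ofLp)) := by
    intro x
    have := closedLoop_form_le hdata hD0 hε₀ hY x.ofLp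
    rwa [← hK, ← hS] at this
  have h2 : ∀ x : Vec n, minEig (S * Ω * S) * ‖x‖ ^ 2 ≤ x.ofLp ⬝ᵥ ((S * Ω * S) *ᵥ x.ofLp) := by
    intro x
    rw [norm_sq_eq_dotProduct]
    exact minEig_mul_le hH _
  have h3 : ∀ x d : Vec n, inner ℝ x (toEuclideanLin S d) ≤ norm2 S * ‖x‖ * ‖d‖ := by
    intro x d
    have := (real_inner_le_norm x (toEuclideanLin S d)).trans
      (mul_le_mul_of_nonneg_left (norm_toEuclideanLin_le S d) (norm_nonneg x))
    linarith
  constructor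
  · intro x e d
    have e1 := mul_le_mul_of_nonneg_left (h1 x) hμ.le
    have e2 := mul_le_mul_of_nonneg_left (h2 x) hμ.le
    have e3 := mul_le_mul_of_nonneg_left (h3 x d) hμ.le
    have e4 := sampled_form_le_quad hD0 hSsymm hε hTrig x e
    have e5 := mul_le_mul_of_nonneg_right (min_le_left (μ / 2 * minEig (S * Ω * S))
      (μ * (minEig (S * Ω * S) - σ₁ * ω))) (sq_nonneg ‖x‖)
    have e6 : 0 ≤ μ * (ω * σ₁) * (‖x‖ * ‖d‖) := by positivity
    rw [hfield]
    linarith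
  · intro x e d D he hd
    have e1 := mul_le_mul_of_nonneg_left (h1 x) hμ.le
    have e2 := mul_le_mul_of_nonneg_left (h2 x) hμ.le
    have e3 := mul_le_mul_of_nonneg_left ((h3 x d).trans (mul_le_mul_of_nonneg_left hd
      (mul_nonneg (norm2_nonneg S) (norm_nonneg x)))) hμ.le
    have e4 := mul_le_mul_of_nonneg_left ((sampled_form_le_omega2 (X1 := X1) hD0 S L x e).trans
      (mul_le_mul_of_nonneg_left he (mul_nonneg hω0 (norm_nonneg x)))) hμ.le
    have e5 := mul_le_mul_of_nonneg_right (min_le_right (μ / 2 * minEig (S * Ω * S))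
      (μ * (minEig (S * Ω * S) - σ₁ * ω))) (sq_nonneg ‖x‖)
    rw [hfield]
    linarith

lemma augNorm_sq {n : ℕ} (x : Vec n) {η : ℝ} (hη : 0 ≤ η) :
    augNorm x η ^ 2 = ‖x‖ ^ 2 + η := by
  unfold augNorm
  rw [Real.sq_sqrt (by positivity), Real.sq_sqrt hη]

lemma augNorm_nonneg {n : ℕ} (x : Vec n) (η : ℝ) : 0 ≤ augNorm x η := Real.sqrt_nonneg _

/-- Decay of a Lyapunov function that is equivalent to the square of the norm, read as a bound on
the norm itself. -/
lemma augNorm_le_of_lyapunov {n : ℕ} {x x₀ : Vec n} {η η₀ V V₀ lo hi c β D ν t : ℝ}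
    (hlo : 0 < lo) (hhi : 0 < hi) (hc : 0 < c) (hβ : 0 ≤ β) (hD : 0 ≤ D) (hν : 0 ≤ ν) (hη : 0 ≤ η)
    (hη₀ : 0 ≤ η₀)
    (hV : lo * (‖x‖ ^ 2 + η) ≤ V) (hV₀ : V₀ ≤ hi * (‖x₀‖ ^ 2 + η₀))
    (h : V - (β * D ^ 2 + ν) / c ≤ Real.exp (-c * t) * (V₀ - (β * D ^ 2 + ν) / c)) :
    augNorm x η ≤ Real.sqrt (hi / lo) * Real.exp (-(c / 2) * t) * augNorm x₀ η₀ +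
      Real.sqrt (β / (c * lo)) * D + Real.sqrt (ν / (c * lo)) := by
  set N := augNorm x η
  set N₀ := augNorm x₀ η₀
  set p := Real.sqrt (hi / lo) * Real.exp (-(c / 2) * t) * N₀ with hp
  set q := Real.sqrt (β / (c * lo)) * D with hq
  set r := Real.sqrt (ν / (c * lo)) with hr
  have hN₀ : 0 ≤ N₀ := augNorm_nonneg _ _
  have hp2 : p ^ 2 = hi / lo * Real.exp (-c * t) * N₀ ^ 2 := by
    rw [hp, mul_pow, mul_pow, Real.sq_sqrt (by positivity), ← Real.exp_nat_mul]
    congr 3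
    push_cast; ring
  have hq2 : q ^ 2 = β / (c * lo) * D ^ 2 := by
    rw [hq, mul_pow, Real.sq_sqrt (by positivity)]
  have hr2 : r ^ 2 = ν / (c * lo) := Real.sq_sqrt (by positivity)
  have hexp := Real.exp_pos (-c * t)
  have hκ : 0 ≤ (β * D ^ 2 + ν) / c := by positivity
  have h1 : lo * N ^ 2 ≤ Real.exp (-c * t) * (hi * N₀ ^ 2) + (β * D ^ 2 + ν) / c := by
    rw [augNorm_sq _ hη, augNorm_sq _ hη₀]
    have h2 := mul_le_mul_of_nonneg_left hV₀ hexp.le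
    have h3 := mul_nonneg hexp.le hκ
    linarith
  have h2 : lo * (p ^ 2 + q ^ 2 + r ^ 2) =
      Real.exp (-c * t) * (hi * N₀ ^ 2) + (β * D ^ 2 + ν) / c := by
    rw [hp2, hq2, hr2]; field_simp; ring
  have h3 : N ^ 2 ≤ p ^ 2 + q ^ 2 + r ^ 2 := le_of_mul_le_mul_left (by rw [h2]; exact h1) hlo
  have hp0 : 0 ≤ p := by positivity
  have hq0 : 0 ≤ q := by positivity
  have hr0 : 0 ≤ r := by positivity
  refine abs_le_of_sq_le_sq' (h3.trans ?_) (by positivity) |>.2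
  nlinarith [mul_nonneg hp0 hq0, mul_nonneg hp0 hr0, mul_nonneg hq0 hr0]

lemma norm_le_supNorm {n : ℕ} {d : ℝ → Vec n} (hd : IsDisturbance d) {s : ℝ} (hs : 0 ≤ s) :
    ‖d s‖ ≤ supNorm d :=
  le_csSup hd.2 ⟨s, hs, rfl⟩

lemma norm_le_supNormOn {n : ℕ} {d : ℝ → Vec n} (hd : IsDisturbance d) {s t : ℝ}
    (hs : s ∈ Icc 0 t) : ‖d s‖ ≤ supNormOn d t :=
  le_csSup (hd.2.mono (image_mono Icc_subset_Ici_self)) ⟨s, hs, rfl⟩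

end EventTriggered

open EventTriggered in
theorem proposition4
    {n m T s : ℕ} (hn : 0 < n) (hm : 0 < m)
    -- the plant, and the data collected from it off-line
    (A : Matrix (Fin n) (Fin n) ℝ) (B : Matrix (Fin n) (Fin m) ℝ)
    (U0 : Matrix (Fin m) (Fin T) ℝ) (X0 X1 D0 : Matrix (Fin n) (Fin T) ℝ)
    (hdata : X1 = A * X0 + B * U0 + D0)
    -- rich data, and a known bound on the unknown noise samples
    (hrich : (Matrix.fromRows U0 X0).rank = m + n)
    (Δ : Matrix (Fin n) (Fin s) ℝ) (hD0 : (Δ * Δ.transpose - D0 * D0.transpose).PosSemidef)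
    -- the controller
    (Ω : Matrix (Fin n) (Fin n) ℝ) (hΩ : Ω.PosDef)
    (ε₀ : ℝ) (hε₀ : 0 < ε₀) (Y : Matrix (Fin T) (Fin n) ℝ)
    (hY : ControllerLMI X0 X1 Δ Ω ε₀ Y)
    (S : Matrix (Fin n) (Fin n) ℝ) (hS : S = (X0 * Y)⁻¹)
    (K : Matrix (Fin m) (Fin n) ℝ) (hK : K = U0 * Y * (X0 * Y)⁻¹)
    -- `G`, `L` and the last block `V0` of a right inverse of the data matrix
    (G : Matrix (Fin T) (Fin n) ℝ)
    (hG : Matrix.fromRows U0 X0 * G = Matrix.fromRows K 1)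
    (L : Matrix (Fin T) (Fin n) ℝ)
    (hL : Matrix.fromRows U0 X0 * L = Matrix.fromRows K 0)
    (J0 : Matrix (Fin T) (Fin m) ℝ) (V0 : Matrix (Fin T) (Fin n) ℝ)
    (hV0 : Matrix.fromRows U0 X0 * Matrix.fromCols J0 V0 = 1)
    -- the matrix of the triggering rule
    (μ ε σ₂ : ℝ) (hμ : 0 < μ) (hε : 0 < ε) (hσ₂ : 0 < σ₂)
    (Ψ : Matrix (Fin n ⊕ Fin n) (Fin n ⊕ Fin n) ℝ) (hΨ : Ψ.IsSymm)
    (hTrig : TriggerLMI X1 Δ Ω S L μ ε σ₂ Ψ)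
    -- the scalar parameters of the triggering rule
    (σ₁ : ℝ) (hσ₁ : 0 < σ₁) (hσ₁' : σ₁ * omega2 X1 Δ S L < minEig (S * Ω * S))
    (τbar : ℝ)
    (hτ : τbar = 0 ∨ τbar = tauD (dataBound X1 Δ V0) (dataBound X1 Δ G) σ₁)
    (lam θ ν : ℝ) (hlam : 0 < lam) (hθ : 0 ≤ θ) (hν : 0 ≤ ν)
    (hcase : τbar = tauD (dataBound X1 Δ V0) (dataBound X1 Δ G) σ₁ ∨ 0 < ν) :
    -- (a) minimum inter-event time
    (∀ (d : ℝ → Vec n) (φ : Arc n), IsDisturbance d →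
      IsMaximalSolution ⟨A, B, K, Ψ, lam, θ, ν, τbar⟩ d φ →
      ∀ k ∈ φ.idx, k + 1 ∈ φ.idx →
        τbar ≤ φ.t (k + 1) - φ.t k ∧
        (0 < θ ∨ τbar = 0 →
          max τbar (tauTilde (dataBound X1 Δ G) (dataBound X1 Δ L) σ₂ ν (supNorm d)) ≤
            φ.t (k + 1) - φ.t k)) ∧
    -- (b) (practical) exponential input-to-state stability
    (∃ c₁ c₂ c₃ c₄ : ℝ, 1 ≤ c₁ ∧ 0 < c₂ ∧ 0 < c₃ ∧ 0 < c₄ ∧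
      ∀ (d : ℝ → Vec n) (φ : Arc n), IsDisturbance d →
        IsMaximalSolution ⟨A, B, K, Ψ, lam, θ, ν, τbar⟩ d φ →
        φ.dom = Set.Ici 0 ∧
        ∀ t : ℝ, 0 ≤ t → 0 ≤ φ.η t ∧
          augNorm (φ.x t) (φ.η t) ≤
            c₁ * Real.exp (-c₂ * t) * augNorm (φ.x 0) (φ.η 0) +
              c₃ * supNormOn d t + c₄ * ν) := by
  have hSsymm : Sᵀ = S := by
    have := hY.2.inv.1
    rwa [IsHermitian, conjTranspose_eq_transpose_of_trivial, ← hS] at this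
  have hSpos : S.PosDef := hS ▸ hY.2.inv
  set P : Loop n m := ⟨A, B, K, Ψ, lam, θ, ν, τbar⟩ with hP
  set cA := dataBound X1 Δ V0 with hcA
  set cΦ := dataBound X1 Δ G with hcΦ
  set cL := dataBound X1 Δ L with hcL
  have hcA0 : 0 ≤ cA := dataBound_nonneg _
  have hcΦ0 : 0 ≤ cΦ := dataBound_nonneg _
  have hA : norm2 A ≤ cA := by
    have h1 : fromRows U0 X0 * V0 = fromRows (0 : Matrix (Fin m) (Fin n) ℝ) 1 := by
      rw [mul_fromCols, ← fromBlocks_one, ← fromCols_fromRows_eq_fromBlocks, fromCols_ext_iff]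
        at hV0
      exact hV0.2
    have h2 := plant_eq_of_data hdata h1
    rw [Matrix.mul_one, Matrix.mul_zero, add_zero] at h2
    rw [h2]
    exact norm2_le_dataBound hD0 V0
  have hΦ : norm2 (A + B * K) ≤ cΦ := by
    have h2 := plant_eq_of_data hdata hG
    rw [Matrix.mul_one] at h2
    rw [h2]
    exact norm2_le_dataBound hD0 G
  have hBK : norm2 (B * K) ≤ cL := by
    have h2 := plant_eq_of_data hdata hL
    rw [Matrix.mul_zero, zero_add] at h2
    rw [h2]
    exact norm2_le_dataBound hD0 L
  have htauD : 0 < tauD cA cΦ σ₁ := tauD_pos hcA0 hσ₁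
  have hτ0 : 0 ≤ P.τ := by
    rcases hτ with h | h
    · exact h.ge
    · exact htauD.le.trans h.ge
  have hquad : ∀ x e : Vec n, quad P.Ψ x e ≤ ‖e‖ ^ 2 - 2 * σ₂ ^ 2 * ‖x‖ ^ 2 := quad_le hTrig
  refine ⟨?_, ?_⟩
  · intro d φ hd hφ k hk hk1
    have hsol := hφ.1
    have h1 : τbar ≤ φ.t (k + 1) - φ.t k := by
      linarith [show _ + τbar ≤ _ from hsol.add_le_t_succ hk1]
    refine ⟨h1, fun hc ↦ max_le h1 ?_⟩
    have h2 : 0 ≤ φ.t (k + 1) - φ.t k := le_trans hτ0 h1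
    unfold tauTilde
    split_ifs with hν'
    · set α := max (max cΦ cL) (σ₂ * supNorm d / Real.sqrt (ν / 2)) with hα
      have h3 : σ₂ / (1 + σ₂) ≤ α * (φ.t (k + 1) - φ.t k) :=
        hsol.inter_event_time hlam hθ hτ0 hc hσ₂ hν' hquad hΦ hBK
          (fun s hs ↦ norm_le_supNorm hd hs) ((le_max_left _ _).trans (le_max_left _ _))
          ((le_max_right _ _).trans (le_max_left _ _)) (le_max_right _ _) hk1
      have hα0 : 0 ≤ α := hcΦ0.trans ((le_max_left _ _).trans (le_max_left _ _))
      rcases hα0.eq_or_lt with h0 | h0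
      · rw [← h0]; simpa using h2
      · rw [one_div, inv_mul_le_iff₀ h0]
        exact h3
    · exact h2
  · set ω₁ := minEig (S * Ω * S) with hω₁
    set ω₂ := omega2 X1 Δ S L with hω₂
    have hω₂0 : 0 ≤ ω₂ := by
      have h1 := norm2_nonneg (S * X1 * L)
      have h2 := mul_nonneg (mul_nonneg (norm2_nonneg S) (norm2_nonneg Δ)) (norm2_nonneg L)
      rw [hω₂]; unfold omega2; linarith
    set a := min (μ / 2 * ω₁) (μ * (ω₁ - σ₁ * ω₂)) with ha
    set b := μ * (ω₂ * σ₁ + 2 * norm2 S) with hb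
    have hSn := norm2_nonneg S
    have ha0 : 0 < a := by
      have h1 : 0 < ω₁ := lt_of_le_of_lt (by positivity) hσ₁'
      exact lt_min (by positivity) (mul_pos hμ (by linarith))
    have hb0 : 0 ≤ b := by positivity
    have hdis : Dissipative P S μ σ₁ a b :=
      dissipative_of_data (P := P) hdata hD0 hΩ hε₀ hY hS hSsymm hK hL hμ hε hσ₁ hTrig
    have hform_le : ∀ x : Vec n, form S x ≤ norm2 S * ‖x‖ ^ 2 := by
      intro x
      have := (real_inner_le_norm x (toEuclideanLin S x)).trans
        (mul_le_mul_of_nonneg_left (norm_toEuclideanLin_le S x) (norm_nonneg x))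
      unfold form
      linarith
    have hle_form : ∀ x : Vec n, minEig S * ‖x‖ ^ 2 ≤ form S x := by
      intro x
      unfold form
      rw [inner_toEuclideanLin, norm_sq_eq_dotProduct]
      exact minEig_mul_le hSpos.1 _
    have hSmin := minEig_pos hn hSpos
    set c := min lam (a / (2 * μ * (norm2 S + 1))) with hc
    have hc0 : 0 < c := lt_min hlam (by positivity)
    have hcS : ∀ x : Vec n, c * (μ * form S x) ≤ a / 2 * ‖x‖ ^ 2 := by
      intro x
      have h1 : c * (2 * μ * (norm2 S + 1)) ≤ a :=
        (le_div_iff₀ (by positivity)).mp (min_le_right _ _)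
      have h2 := mul_le_mul_of_nonneg_left (hform_le x) (show 0 ≤ c * μ by positivity)
      have h3 := mul_le_mul_of_nonneg_right h1 (sq_nonneg ‖x‖)
      have h4 : 0 ≤ c * μ * ‖x‖ ^ 2 := by positivity
      linarith
    set lo := min (μ * minEig S) 1 with hlo
    set hi := max (μ * norm2 S) 1 with hhi
    have hlo0 : 0 < lo := lt_min (by positivity) one_pos
    have hhi1 : 1 ≤ hi := le_max_right _ _
    set β := b ^ 2 / (2 * a) with hβ
    have hβ0 : 0 ≤ β := by positivity
    refine ⟨Real.sqrt (hi / lo), c / 2, Real.sqrt (β / (c * lo)) + 1,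
      Real.sqrt (ν / (c * lo)) / ν + 1, ?_, by positivity, by positivity, by positivity, ?_⟩
    · rw [Real.one_le_sqrt, one_le_div hlo0]
      exact (min_le_right _ _).trans hhi1
    intro d φ hd hφ
    have hsol := hφ.1
    have hdom : φ.dom = Set.Ici 0 := by
      have hν0 : P.τ = 0 → 0 < P.ν := fun h0 ↦ hcase.resolve_left fun h1 ↦ by
        have h2 : τbar = 0 := h0
        linarith
      have hq0 : ∀ x : Vec n, quad P.Ψ x 0 ≤ 0 := fun x ↦ by
        have h1 := hquad x 0
        have h2 : 0 ≤ 2 * σ₂ ^ 2 * ‖x‖ ^ 2 := by positivity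
        rw [norm_zero] at h1
        linarith
      rcases hτ with h | h
      · -- without a dwell time, the growth rate of the relative error bounds the gaps from below
        have hν' : 0 < P.ν := hν0 h
        set α := max (max (max cΦ cL) (σ₂ * supNorm d / Real.sqrt (ν / 2))) 1 with hα
        have hα0 : 0 < α := lt_of_lt_of_le one_pos (le_max_right _ _)
        refine hφ.dom_eq_Ici hd hlam hθ hτ0 hν0 hq0 (g := σ₂ / (1 + σ₂) / α) (by positivity) ?_
        intro k hk1
        rw [div_le_iff₀ hα0, mul_comm]
        exact hsol.inter_event_time hlam hθ hτ0 (Or.inr h) hσ₂ hν' hquad hΦ hBK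
          (fun s hs ↦ norm_le_supNorm hd hs)
          ((le_max_left _ _).trans ((le_max_left _ _).trans (le_max_left _ _)))
          ((le_max_right _ _).trans ((le_max_left _ _).trans (le_max_left _ _)))
          ((le_max_right _ _).trans (le_max_left _ _)) hk1
      · refine hφ.dom_eq_Ici hd hlam hθ hτ0 hν0 hq0 (g := τbar) (h ▸ htauD) ?_
        intro k hk1
        linarith [show _ + τbar ≤ _ from hsol.add_le_t_succ hk1]
    refine ⟨hdom, fun t ht ↦ ?_⟩
    have htd : t ∈ φ.dom := hdom ▸ ht
    have hηt : 0 ≤ φ.η t := hsol.η_nonneg hlam hθ hτ0 htd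
    refine ⟨hηt, ?_⟩
    set D := supNormOn d t with hD
    have hdD : ∀ u ∈ Set.Icc 0 t, ‖d u‖ ≤ D := fun u hu ↦ norm_le_supNormOn hd hu
    have hD0' : 0 ≤ D := (norm_nonneg _).trans (hdD 0 ⟨le_rfl, ht⟩)
    have hW := hsol.lyapunov hlam hθ hτ0 hν hSsymm ha0 hb0 hdis hc0 (min_le_left _ _) hcS htd hdD
      (by
        intro k hk u hu hut hlt
        rcases hτ with h | h
        · have h0 : P.τ = 0 := h
          rw [h0, add_zero] at hlt
          exact absurd hu.2.1 (not_le.mpr hlt)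
        · have h0 : P.τ = tauD cA cΦ σ₁ := h
          rw [h0] at hlt
          exact hsol.error_le hA hΦ hσ₁ hk hu (fun v hv ↦ hdD v ⟨hv.1, hv.2.trans hut⟩) hlt.le)
    have hbound := augNorm_le_of_lyapunov (x := φ.x t) (x₀ := φ.x 0) (lo := lo) (hi := hi) hlo0
      (by linarith) hc0 hβ0 hD0' hν hηt hsol.η_init
      (by
        have h1 := mul_le_mul_of_nonneg_left (hle_form (φ.x t)) hμ.le
        have h2 := mul_le_mul_of_nonneg_right (min_le_left (μ * minEig S) 1)
          (sq_nonneg ‖φ.x t‖)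
        have h3 := mul_le_mul_of_nonneg_right (min_le_right (μ * minEig S) 1) hηt
        linarith)
      (by
        have h1 := mul_le_mul_of_nonneg_left (hform_le (φ.x 0)) hμ.le
        have h2 := mul_le_mul_of_nonneg_right (le_max_left (μ * norm2 S) 1)
          (sq_nonneg ‖φ.x 0‖)
        have h3 := mul_le_mul_of_nonneg_right (le_max_right (μ * norm2 S) 1) hsol.η_init
        linarith) hW
    -- the offset is of the order of `√ν`, and is absorbed by letting `c₄` depend on `ν`
    have hoff : Real.sqrt (ν / (c * lo)) ≤ (Real.sqrt (ν / (c * lo)) / ν + 1) * ν := by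
      rcases hν.eq_or_lt with h0 | h0
      · simp [← h0]
      · rw [add_mul, div_mul_cancel₀ _ h0.ne']
        linarith
    linarith
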